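/- \textbf{Definitions.} For $x\in\mathbb{R}^n$ write $|x|_{(1)}\ge|x|_{(2)}\ge\dots\ge|x|_{(n)}$ for the absolute values of its coordinates in decreasing order, let $H_k(x)\in\mathbb{R}^n$ be obtained from $x$ by keeping the $k$ coordinates of largest absolute value (ties broken by smaller index) and replacing the others by $0$, and let $x_{\overline{[k]}}=x-H_k(x)$. The top-$k$ estimation error of $\widehat x$ is \[E_k(x,\widehat x)=\inf\{\|x-x'\|_2 : x'\in\mathbb{R}^n,\ H_k(x')=H_k(\widehat x)\}.\] The Count-Sketch of $x$ with $R$ rows and $C$ columns uses hash functions $h_u:[n]\to[C]$ and sign functions $s_u:[n]\to\{\pm1\}$ for $u\in[R]$, all of whose values are independent and uniformly distributed; it stores $y_{u,v}=\sum_{i:h_u(i)=v}s_u(i)x_i$, and its estimate $\widehat x$ of $x$ is $\widehat x_i=\operatorname{median}_{u\in[R]}\, s_u(i)\,y_{u,h_u(i)}$ (for even $R$ the median is the average of the two middle values). \textbf{Theorem.} For every $d>0$ there is a constant $A>0$ such that for every $\alpha>0$ there is a constant $c_0>0$ such that for every $c_1\ge c_0$ there is a constant $K>0$ with the following property. Let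 $n,k,R,C$ be natural numbers with $k\ge1$, $2k\le n$, $R\ge A\log n$ and $c_0k\le C\le c_1k$, and let $x\in\mathbb{R}^n$ satisfy \[|x|_{(k)}-|x|_{(2k)}\ \ge\ \alpha\,\frac{\|x_{\overline{[k]}}\|_2}{\sqrt k}.\] Then the Count-Sketch estimate $\widehat x$ of $x$ with $R$ rows and $C$ columns satisfies \[E_k(x,\widehat x)^2\ \le\ \frac1R\,\|x_{\overline{[k]}}\|_2^2\] with probability at least $1-K/k^{d}$. -/

import Mathlib

namespace CountSketch

noncomputable section

/-- The Euclidean norm of a real vector. -/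
def l2norm {n : ℕ} (v : Fin n → ℝ) : ℝ := ‖WithLp.toLp 2 v‖

/-- The permutation that lists the coordinates of `x` by decreasing magnitude:
`bySize x 0` is the index of the largest coordinate in absolute value, `bySize x 1` that of the
second largest, and so on; ties are broken in favour of the smaller index. -/
def bySize {n : ℕ} (x : Fin n → ℝ) : Equiv.Perm (Fin n) :=
  Tuple.sort fun i => -|x i|

/-- The `j`-th largest magnitude of a coordinate of `x`, for `1 ≤ j ≤ n`
(and `0` by convention if `j > n`). -/
def mag {n : ℕ} (x : Fin n → ℝ) (j : ℕ) : ℝ :=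
  if h : j - 1 < n then |x (bySize x ⟨j - 1, h⟩)| else 0

/-- `H_k(x)`: the restriction of `x` to its `k` largest coordinates in absolute value
(the other coordinates are replaced by `0`). -/
def head {n : ℕ} (k : ℕ) (x : Fin n → ℝ) : Fin n → ℝ :=
  fun i => if (((bySize x).symm i : Fin n) : ℕ) < k then x i else 0

/-- The vector obtained from `x` by replacing its `k` largest coordinates in absolute value
by `0`. -/
def tail {n : ℕ} (k : ℕ) (x : Fin n → ℝ) : Fin n → ℝ := x - head k x

/-- The top-`k` estimation error of `y` as an estimate of `x`: the distance from `x` to the set of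
vectors that have the same `k` largest coordinates as `y`. -/
def topError {n : ℕ} (k : ℕ) (x y : Fin n → ℝ) : ℝ :=
  ⨅ z : {z : Fin n → ℝ // head k z = head k y}, l2norm (x - z.1)

/-- The median of `R` real numbers: the middle one in sorted order if `R` is odd, the average of
the two middle ones if `R` is even (and `0` by convention if `R = 0`). -/
def median {R : ℕ} (a : Fin R → ℝ) : ℝ :=
  if h : 0 < R then
    (a (Tuple.sort a ⟨(R - 1) / 2, by omega⟩) + a (Tuple.sort a ⟨R / 2, by omega⟩)) / 2
  else 0

/-- The random choices of a Count-Sketch with `R` rows and `C` columns for vectors of length `n`: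
for each row `u` a hash function `h u` from coordinates to columns, and a sign function `s u`. -/
abbrev Hashing (n R C : ℕ) : Type := (Fin R → Fin n → Fin C) × (Fin R → Fin n → ℤˣ)

/-- The law of fully random hash and sign functions: the uniform distribution on all choices, under
which all the values `h u i` and `s u i` are independent and uniform. -/
def law (n R C : ℕ) : MeasureTheory.Measure (Hashing n R C) :=
  ProbabilityTheory.uniformOn Set.univ

/-- The sketch `y u v = ∑_{i : h u i = v} s u i * x i`. -/
def sketch {n R C : ℕ} (ω : Hashing n R C) (x : Fin n → ℝ) (u : Fin R) (v : Fin C) : ℝ :=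
  ∑ i with ω.1 u i = v, ((ω.2 u i : ℤ) : ℝ) * x i

/-- The Count-Sketch estimate: its `i`-th coordinate is the median over the rows `u` of
`s u i * y u (h u i)`. -/
def estimate {n R C : ℕ} (ω : Hashing n R C) (x : Fin n → ℝ) : Fin n → ℝ :=
  fun i => median fun u => ((ω.2 u i : ℤ) : ℝ) * sketch ω x u (ω.1 u i)

end

end CountSketch

/-!
The sketch is analysed one row at a time, through exponential moments of the row errors
`rowError x h s i`, the signed sums of the coordinates that collide with `i`.

*Symmetrization.* The columns are grouped in pairs, and the hash function of a row is resampled inside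
the pairs (`expect_row_eq_expect_flip`). Conditionally on the pairs, errors at coordinates in different
pairs are independent, and the error at `i` is the mean of two independent copies of one Rademacher sum
over the coordinates hashed to the pair of `i` (`rowError_flip_eq`). By the pigeonhole principle two
copies of a random variable with standard deviation at most `σ` are `ε * σ`-close with probability of
order `ε` (`le_expect_abs_sub_le`), so a row error exceeds `ε * σ` in a given direction with probability
at most `1 / 2 - ε / 16`, as soon as the pair of `i` contains no head coordinate and not too much of the
tail. This happens with probability at least one half when `C` is a large multiple of `k`, and then
`σ ^ 2 = 40 * ‖tail‖ ^ 2 / C` will do.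

*Joint deviations.* Two coordinates share a pair with probability at most `2 / C`, so the errors at a set
`T` of `O(log k)` coordinates are nearly independent, and the exponential moment of their exceedances in
one row is at most `exp (-∑ ε i ^ 2 / 10000)` (`expect_row_exp_le`). Rows are independent and a median can
only be off if half of the rows are, which gives a joint subgaussian tail at scale `σ / √R` for the
estimates at the coordinates of `T` (`law_real_deviation_le`).

*Blocks.* The top `2k` coordinates are cut into blocks of size `p` of order `log k`. If a block has a
squared error much larger than `p * σ ^ 2 / R`, then its errors dominate one of at most `4 ^ p` profiles,
each of probability at most `2 ^ p * exp (-4 * p)` (`law_real_block_le`), and a union bound over the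
blocks controls the squared error on the top `2k` coordinates.

*Top-`k` error.* Once every estimate is accurate up to a third of the gap between the `k`-th and the
`2k`-th largest magnitude, only the top `2k` coordinates of `x` contribute to the top-`k` error
(`topError_sq_le`).
-/

namespace CountSketch

open Finset
open scoped BigOperators

/-! ### Averages over finite product spaces -/

/-- Functions of disjoint blocks of coordinates are uncorrelated under the uniform distribution. -/
lemma expect_mul_of_disjoint_support {ι D : Type*} [Fintype ι] [DecidableEq ι] [Fintype D]
    [Nonempty D] (p : ι → Prop) [DecidablePred p] (f g : (ι → D) → ℝ)
    (hf : ∀ x y, (∀ j, p j → x j = y j) → f x = f y)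
    (hg : ∀ x y, (∀ j, ¬ p j → x j = y j) → g x = g y) :
    𝔼 x, f x * g x = (𝔼 x, f x) * 𝔼 x, g x := by
  rw [Fintype.expect_mul_expect]
  -- Swapping the coordinates in `p` between the two copies is an involution of pairs.
  let e : (ι → D) × (ι → D) → (ι → D) × (ι → D) := fun z =>
    (fun j => if p j then z.1 j else z.2 j, fun j => if p j then z.2 j else z.1 j)
  have he : Function.Involutive e := by
    intro z
    ext j <;> by_cases h : p j <;> simp [e, h]
  have h1 : 𝔼 x, 𝔼 y, f x * g y = 𝔼 z : (ι → D) × (ι → D), f z.1 * g z.2 := by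
    rw [← univ_product_univ, expect_product]
  have h2 : 𝔼 z : (ι → D) × (ι → D), f z.1 * g z.1 = 𝔼 x, f x * g x := by
    rw [← univ_product_univ, expect_product]
    simp
  rw [h1, ← h2]
  refine Fintype.expect_bijective e he.bijective _ _ fun z => ?_
  congr 1
  · exact hf _ _ fun j hj => by simp [e, hj]
  · exact hg _ _ fun j hj => by simp [e, hj]

lemma expect_prod_of_disjoint_support {ι D κ : Type*} [Fintype ι] [DecidableEq ι] [Fintype D]
    [Nonempty D] [DecidableEq κ] (q : ι → κ) (F : κ → (ι → D) → ℝ)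
    (hF : ∀ c x y, (∀ j, q j = c → x j = y j) → F c x = F c y) (s : Finset κ) :
    𝔼 x, ∏ c ∈ s, F c x = ∏ c ∈ s, 𝔼 x, F c x := by
  induction s using Finset.induction_on with
  | empty => simp
  | insert c s hc ih =>
    simp only [prod_insert hc]
    rw [← ih]
    refine expect_mul_of_disjoint_support (fun j => q j = c) _ _ (hF c) fun x y h => ?_
    refine prod_congr rfl fun c' hc' => hF c' x y fun j hj => h j ?_
    rintro rfl
    exact hc (hj ▸ hc')

lemma expect_pi_prod {R : ℕ} {α : Type*} [Fintype α] [Nonempty α] (F : Fin R → α → ℝ) :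
    𝔼 ρ : Fin R → α, ∏ u, F u (ρ u) = ∏ u, 𝔼 a, F u a := by
  classical
  rw [expect_prod_of_disjoint_support (fun u : Fin R => u) (fun u ρ => F u (ρ u))]
  · refine prod_congr rfl fun u _ => ?_
    rw [Fintype.expect_eq_sum_div_card, Fintype.expect_eq_sum_div_card]
    rw [div_eq_div_iff (by positivity) (by positivity)]
    have h := Fintype.sum_fiberwise (fun ρ : Fin R → α => ρ u) (fun ρ => F u (ρ u))
    have hc (a : α) : Fintype.card α * #{ρ : Fin R → α | ρ u = a} = Fintype.card (Fin R → α) := by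
      have : Fintype.piFinset (fun v : Fin R => if v = u then {a} else (univ : Finset α))
          = ({ρ : Fin R → α | ρ u = a} : Finset _) := by
        ext ρ
        simp only [Fintype.mem_piFinset, mem_filter, mem_univ, true_and]
        constructor
        · intro h
          simpa using h u
        · rintro rfl v
          by_cases h : v = u <;> simp [h]
      rw [← this, Fintype.card_piFinset]
      simp only [apply_ite card, card_singleton, card_univ, Fintype.card_pi, prod_const,
        Fintype.card_fin]
      rw [← mul_prod_erase univ _ (mem_univ u)]
      rw [prod_congr rfl (g := fun _ => Fintype.card α) fun v hv => by
        simp [ne_of_mem_erase hv]]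
      simp only [if_true, one_mul, prod_const]
      rw [← pow_succ', card_erase_of_mem (mem_univ u), card_univ, Fintype.card_fin,
        Nat.sub_add_cancel (Fin.pos u)]
    rw [← h]
    have h3 (a : α) : ∑ ρ : {ρ : Fin R → α // ρ u = a}, F u ((ρ : Fin R → α) u) =
        #{ρ : Fin R → α | ρ u = a} * F u a := by
      rw [Finset.sum_congr rfl (g := fun _ => F u a) fun ρ _ => by rw [ρ.2]]
      simp [Fintype.card_subtype]
    simp only [h3, sum_mul]
    refine sum_congr rfl fun a _ => ?_
    rw [← hc a]
    push_cast
    ring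
  · intro c x y h
    simp [h c rfl]

instance : MeasurableSingletonClass ℤˣ where
  measurableSet_singleton u :=
    ⟨{(u : ℤ)}, measurableSet_singleton _, by ext v; simp [Units.val_inj]⟩

/-- Probabilities under the law of the hash and sign functions are finite averages. -/
lemma law_real_eq_expect {n R C : ℕ} [NeZero C] (s : Set (Hashing n R C)) [DecidablePred (· ∈ s)] :
    (law n R C).real s = 𝔼 ω, if ω ∈ s then (1 : ℝ) else 0 := by
  classical
  rw [Fintype.expect_eq_sum_div_card, law, MeasureTheory.measureReal_def,
    ProbabilityTheory.uniformOn_univ, MeasureTheory.Measure.count_apply (Set.toFinite s).measurableSet,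
    Finset.sum_boole, ENNReal.toReal_div]
  simp [Set.encard_eq_coe_toFinset_card, Set.toFinset_card, Fintype.card_subtype]

instance {n R C : ℕ} [NeZero C] : MeasureTheory.IsProbabilityMeasure (law n R C) := by
  unfold law; infer_instance

/-- The average over the whole sketch of a product of functions of the rows factorizes. -/
lemma expect_hashing_prod {n R C : ℕ} [NeZero C]
    (F : (Fin n → Fin C) → (Fin n → ℤˣ) → ℝ) :
    𝔼 ω : Hashing n R C, ∏ u, F (ω.1 u) (ω.2 u) = (𝔼 h, 𝔼 s, F h s) ^ R := by
  have h1 : 𝔼 ω : Hashing n R C, ∏ u, F (ω.1 u) (ω.2 u)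
      = 𝔼 ρ : Fin R → (Fin n → Fin C) × (Fin n → ℤˣ), ∏ u, F (ρ u).1 (ρ u).2 :=
    Fintype.expect_equiv (Equiv.arrowProdEquivProdArrow _ _ _).symm _ _ fun ω => rfl
  rw [h1, expect_pi_prod (fun _ (a : (Fin n → Fin C) × (Fin n → ℤˣ)) => F a.1 a.2), prod_const, card_univ, Fintype.card_fin,
    ← univ_product_univ, expect_product]

/-! ### Elementary probability bounds -/

/-- Two independent copies of a random variable of second moment at most `σ ^ 2` differ by at most
`2 * ε * σ` with probability at least `ε / 8`: by Chebyshev's inequality the variable mostly lies in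
the union of about `4 / ε` intervals of length `2 * ε * σ`, and both copies pick the same interval with
probability at least of the order of the reciprocal of their number. -/
lemma le_expect_abs_sub_le {Ω : Type*} [Fintype Ω] [Nonempty Ω] (Y : Ω → ℝ) {σ ε : ℝ} (hσ : 0 ≤ σ)
    (hε : 0 < ε) (hε1 : ε ≤ 1) (hY : 𝔼 a, Y a ^ 2 ≤ σ ^ 2) :
    ε / 8 ≤ 𝔼 a, 𝔼 b, if |Y a - Y b| ≤ 2 * (ε * σ) then (1 : ℝ) else 0 := by
  classical
  rcases hσ.eq_or_lt with rfl | hσ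
  · have h0 : ∀ a, Y a = 0 := by
      have := (Fintype.expect_eq_zero_iff_of_nonneg (f := fun a => Y a ^ 2)
        (fun a => sq_nonneg _)).1 (le_antisymm (by simpa using hY)
          (expect_nonneg fun a _ => sq_nonneg _))
      intro a
      simpa using congrFun this a
    simp [h0]
    linarith
  set N := Fintype.card Ω with hN
  have hNpos : (0 : ℝ) < N := by simp [hN, Fintype.card_pos]
  let G : Finset Ω := {a | |Y a| ≤ 2 * σ}
  obtain ⟨f, hf⟩ : ∃ f : Ω → ℤ, ∀ a, f a = ⌊Y a / (2 * (ε * σ))⌋ := ⟨_, fun _ => rfl⟩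
  have hεσ : 0 < ε * σ := by positivity
  -- Chebyshev's inequality
  have hG : 3 / 4 * (N : ℝ) ≤ #G := by
    have h1 : 𝔼 a, (if a ∈ G then (0 : ℝ) else 4 * σ ^ 2) ≤ σ ^ 2 := by
      refine le_trans (expect_le_expect fun a _ => ?_) hY
      split_ifs with h
      · positivity
      · simp only [G, mem_filter, mem_univ, true_and, not_le] at h
        rw [← sq_abs (Y a)]
        nlinarith
    rw [Fintype.expect_eq_sum_div_card, div_le_iff₀ (by exact_mod_cast hNpos)] at h1
    have h2 : ∑ a, (if a ∈ G then (0 : ℝ) else 4 * σ ^ 2) = (N - #G) * (4 * σ ^ 2) := by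
      have : ∀ a, (if a ∈ G then (0 : ℝ) else 4 * σ ^ 2)
          = 4 * σ ^ 2 - if a ∈ G then 4 * σ ^ 2 else 0 := by
        intro a; split_ifs <;> ring
      simp only [this, sum_sub_distrib, sum_ite_mem, univ_inter, sum_const, card_univ, nsmul_eq_mul]
      ring
    rw [h2, ← hN] at h1
    have h3 : 0 < σ ^ 2 := by positivity
    have : ((N : ℝ) - #G) * 4 ≤ N := by
      by_contra hcon
      push Not at hcon
      nlinarith
    linarith
  let I : Finset ℤ := Finset.Icc ⌊-(1 / ε)⌋ ⌊1 / ε⌋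
  have hI : (#I : ℝ) ≤ 4 / ε := by
    have h0 : 0 < 1 / ε := by positivity
    have h0' : 1 ≤ 1 / ε := by rw [le_div_iff₀ hε]; linarith
    have h1 : (#I : ℤ) = ⌊1 / ε⌋ + 1 - ⌊-(1 / ε)⌋ := by
      have : ⌊-(1 / ε)⌋ ≤ ⌊1 / ε⌋ := Int.floor_le_floor (by linarith)
      simp only [I, Int.card_Icc]
      rw [Int.toNat_of_nonneg (by lia)]
    have h2 : (#I : ℝ) = ⌊1 / ε⌋ + 1 - ⌊-(1 / ε)⌋ := by exact_mod_cast h1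
    have h3 := Int.floor_le (1 / ε)
    have h4 := Int.sub_one_lt_floor (-(1 / ε))
    rw [h2]
    have : 4 / ε = 4 * (1 / ε) := by ring
    linarith
  have hmaps : ∀ a ∈ G, f a ∈ I := by
    intro a ha
    simp only [G, mem_filter, mem_univ, true_and] at ha
    have h := abs_le.1 ha
    have h1 : Y a / (2 * (ε * σ)) ≤ 1 / ε := by
      rw [div_le_div_iff₀ (by positivity) hε]; nlinarith
    have h2 : -(1 / ε) ≤ Y a / (2 * (ε * σ)) := by
      rw [← neg_div, div_le_div_iff₀ hε (by positivity)]; nlinarith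
    simp only [I, Finset.mem_Icc, hf]
    exact ⟨Int.floor_le_floor h2, Int.floor_le_floor h1⟩
  have hcard : #G = ∑ m ∈ I, #{a ∈ G | f a = m} := card_eq_sum_card_fiberwise hmaps
  have hCS : (#G : ℝ) ^ 2 ≤ #I * ∑ m ∈ I, (#{a ∈ G | f a = m} : ℝ) ^ 2 := by
    rw [hcard]; push_cast
    exact sq_sum_le_card_mul_sum_sq
  have hpairs : ∑ m ∈ I, (#{a ∈ G | f a = m} : ℝ) ^ 2 ≤
      ∑ a, ∑ b, if |Y a - Y b| ≤ 2 * (ε * σ) then (1 : ℝ) else 0 := by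
    have h1 : ∀ m, (#{a ∈ G | f a = m} : ℝ) ^ 2
        = ∑ a ∈ G, ∑ b ∈ G, if f a = m ∧ f b = m then (1 : ℝ) else 0 := by
      intro m
      rw [sq, card_filter, Nat.cast_sum, sum_mul_sum]
      refine sum_congr rfl fun a _ => sum_congr rfl fun b _ => ?_
      by_cases h : f a = m <;> by_cases h' : f b = m <;> simp [h, h']
    simp only [h1]
    rw [sum_comm]
    refine le_trans (sum_le_sum fun a ha => ?_)
      (sum_le_sum_of_subset_of_nonneg (subset_univ G) fun a _ _ =>
        sum_nonneg fun b _ => by split_ifs <;> norm_num)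
    rw [sum_comm]
    refine le_trans (sum_le_sum fun b hb => ?_)
      (sum_le_sum_of_subset_of_nonneg (subset_univ G) fun b _ _ => by split_ifs <;> norm_num)
    by_cases hab : f a = f b
    · have hlt : |Y a - Y b| ≤ 2 * (ε * σ) := by
        have := Int.abs_sub_lt_one_of_floor_eq_floor (hf a ▸ hf b ▸ hab)
        rw [← sub_div, abs_div, abs_of_pos (by positivity : 0 < 2 * (ε * σ)),
          div_lt_one (by positivity)] at this
        exact this.le
      rw [if_pos hlt, hab]
      simp only [and_self]
      rw [sum_ite_eq]
      split_ifs <;> norm_num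
    · have : ∀ m, ¬ (f a = m ∧ f b = m) := fun m h => hab (h.1.trans h.2.symm)
      simp only [this, if_false, sum_const_zero]
      split_ifs <;> norm_num
  simp only [Fintype.expect_eq_sum_div_card, ← sum_div]
  rw [div_div, le_div_iff₀ (by positivity)]
  have hS : 0 ≤ ∑ m ∈ I, (#{a ∈ G | f a = m} : ℝ) ^ 2 := sum_nonneg fun m _ => sq_nonneg _
  have h1 : (3 / 4 * (N : ℝ)) ^ 2 ≤ 4 / ε * ∑ m ∈ I, (#{a ∈ G | f a = m} : ℝ) ^ 2 :=
    le_trans (pow_le_pow_left₀ (by linarith) hG 2) (hCS.trans (mul_le_mul_of_nonneg_right hI hS))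
  rw [div_mul_eq_mul_div 4 ε, le_div_iff₀ hε] at h1
  rw [← hN]
  have h2 : 0 ≤ ε * (N : ℝ) ^ 2 := by positivity
  linarith

/-- A random variable with non-positive mean and values in `[-r, r]` has exponential moment at most
`exp (r ^ 2 / 2)`, with the mean entering as an additive saving. -/
lemma expect_exp_le {Ω : Type*} [Fintype Ω] [Nonempty Ω] (Y : Ω → ℝ) {r : ℝ} (hr : 0 ≤ r)
    (hY : ∀ a, |Y a| ≤ r) (hm : 𝔼 a, Y a ≤ 0) :
    𝔼 a, Real.exp (Y a) ≤ Real.exp (r ^ 2 / 2) + 𝔼 a, Y a := by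
  rcases hr.eq_or_lt with rfl | hr
  · have : ∀ a, Y a = 0 := fun a => by simpa using hY a
    simp [this]
  have hchord : ∀ a, Real.exp (Y a) ≤ Real.cosh r + Y a * (Real.sinh r / r) := by
    intro a
    have h := abs_le.1 (hY a)
    have hc := convexOn_exp.2 (Set.mem_univ (-r)) (Set.mem_univ r)
      (show 0 ≤ (r - Y a) / (2 * r) by apply div_nonneg <;> linarith)
      (show 0 ≤ (r + Y a) / (2 * r) by apply div_nonneg <;> linarith)
      (by field_simp; ring)
    simp only [smul_eq_mul] at hc
    have e1 : (r - Y a) / (2 * r) * -r + (r + Y a) / (2 * r) * r = Y a := by field_simp; ring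
    rw [e1] at hc
    refine hc.trans (le_of_eq ?_)
    rw [Real.cosh_eq, Real.sinh_eq]
    field_simp
    ring
  calc 𝔼 a, Real.exp (Y a) ≤ 𝔼 a, (Real.cosh r + Y a * (Real.sinh r / r)) :=
        expect_le_expect fun a _ => hchord a
    _ = Real.cosh r + (𝔼 a, Y a) * (Real.sinh r / r) := by
        rw [expect_add_distrib, Fintype.expect_const, expect_mul]
    _ ≤ Real.exp (r ^ 2 / 2) + (𝔼 a, Y a) * 1 := by
        have h1 : 1 ≤ Real.sinh r / r := by
          rw [le_div_iff₀ hr, one_mul]; exact Real.self_le_sinh_iff.2 hr.le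
        exact add_le_add (Real.cosh_le_exp_half_sq r) (mul_le_mul_of_nonpos_left h1 hm)
    _ = _ := by rw [mul_one]

/-! ### Pairing the columns -/

/-- The columns are paired as `{2m, 2m+1}`; `twin c` is the partner of `c`. If the number of columns
is odd, the last column is its own partner. -/
def twin {C : ℕ} (c : Fin C) : Fin C :=
  if h : (c : ℕ) % 2 = 0 then
    if h' : (c : ℕ) + 1 < C then ⟨c + 1, h'⟩ else c
  else ⟨c - 1, by omega⟩

/-- The number of the pair that contains the column `c`. -/
def pairIdx {C : ℕ} (c : Fin C) : ℕ := c / 2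

lemma twin_involutive {C : ℕ} : Function.Involutive (twin : Fin C → Fin C) := by
  intro c
  ext
  unfold twin
  split_ifs <;> simp_all <;> lia

lemma pairIdx_twin {C : ℕ} (c : Fin C) : pairIdx (twin c) = pairIdx c := by
  unfold pairIdx twin
  split_ifs <;> simp <;> lia

lemma pairIdx_eq_iff {C : ℕ} (c c' : Fin C) : pairIdx c = pairIdx c' ↔ c = c' ∨ c = twin c' := by
  simp only [Fin.ext_iff]
  unfold pairIdx twin
  split_ifs <;> simp <;> lia

lemma card_twin_eq_self_le (C : ℕ) : #{c : Fin C | twin c = c} ≤ 1 := by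
  rw [card_le_one]
  intro a ha b hb
  simp only [mem_filter, mem_univ, true_and, Fin.ext_iff] at ha hb
  ext
  unfold twin at ha hb
  split_ifs at ha hb <;> simp at ha hb <;> lia

lemma card_pairIdx_eq_le {C : ℕ} (c' : Fin C) : #{c : Fin C | pairIdx c = pairIdx c'} ≤ 2 := by
  refine (card_le_card (t := {c', twin c'}) fun c hc => ?_).trans card_le_two
  simpa [pairIdx_eq_iff] using hc

/-! ### Hash collisions -/

/-- A uniform hash value lands in a set determined by the other hash values with probability at most
`m / C`, where `m` bounds the size of this set. -/
lemma expect_hash_mem_le {n C m : ℕ} [NeZero C] (j : Fin n) (P : (Fin n → Fin C) → Finset (Fin C))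
    (hP : ∀ h c, P (h + Pi.single j c) = P h) (hm : ∀ h, #(P h) ≤ m) :
    𝔼 h, (if h j ∈ P h then (1 : ℝ) else 0) ≤ m / C := by
  have h1 (t : Fin C) : 𝔼 h : Fin n → Fin C, (if h j ∈ P h then (1 : ℝ) else 0)
      = 𝔼 h : Fin n → Fin C, (if h j + t ∈ P h then (1 : ℝ) else 0) := by
    symm
    refine Fintype.expect_equiv (Equiv.addRight (Pi.single j t)) _ _ fun h => ?_
    simp [hP]
  have h2 : 𝔼 h : Fin n → Fin C, (if h j ∈ P h then (1 : ℝ) else 0)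
      = 𝔼 h : Fin n → Fin C, 𝔼 t : Fin C, (if h j + t ∈ P h then (1 : ℝ) else 0) := by
    rw [expect_comm, expect_congr rfl (fun t _ => (h1 t).symm), Fintype.expect_const]
  rw [h2]
  refine expect_le univ_nonempty fun h _ => ?_
  have h3 : 𝔼 t : Fin C, (if h j + t ∈ P h then (1 : ℝ) else 0)
      = 𝔼 c, (if c ∈ P h then (1 : ℝ) else 0) :=
    Fintype.expect_equiv (Equiv.addLeft (h j)) _ _ fun t => rfl
  rw [h3, Fintype.expect_eq_sum_div_card, Fintype.card_fin, sum_boole]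
  have := hm h
  gcongr
  simpa using this

lemma expect_pairIdx_eq_le {n C : ℕ} [NeZero C] {i j : Fin n} (hij : j ≠ i) :
    𝔼 h : Fin n → Fin C, (if pairIdx (h j) = pairIdx (h i) then (1 : ℝ) else 0) ≤ 2 / C := by
  have := expect_hash_mem_le (m := 2) (C := C) j
    (fun h => ({c | pairIdx c = pairIdx (h i)} : Finset (Fin C)))
    (fun h c => by simp [hij.symm]) (fun h => card_pairIdx_eq_le _)
  simpa using this

lemma expect_twin_eq_self_le {n C : ℕ} [NeZero C] (i : Fin n) :
    𝔼 h : Fin n → Fin C, (if twin (h i) = h i then (1 : ℝ) else 0) ≤ 1 / C := by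
  have := expect_hash_mem_le (m := 1) (C := C) i
    (fun _ => ({c | twin c = c} : Finset (Fin C)))
    (fun h c => rfl) (fun h => card_twin_eq_self_le C)
  simpa using this

/-! ### Random signs -/

/-- A sign as a real number. -/
def signVal (u : ℤˣ) : ℝ := ((u : ℤ) : ℝ)

@[simp] lemma signVal_mul (u v : ℤˣ) : signVal (u * v) = signVal u * signVal v := by
  simp [signVal]

@[simp] lemma signVal_neg (u : ℤˣ) : signVal (-u) = -signVal u := by
  simp [signVal]

@[simp] lemma signVal_one : signVal 1 = 1 := by simp [signVal]

@[simp] lemma signVal_mul_self (u : ℤˣ) : signVal u * signVal u = 1 := by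
  rw [← signVal_mul, Int.units_mul_self, signVal_one]

lemma expect_comp_mul {n : ℕ} (v : Fin n → ℤˣ) (f : (Fin n → ℤˣ) → ℝ) :
    𝔼 a, f (v * a) = 𝔼 a, f a :=
  Fintype.expect_equiv (Equiv.mulLeft v) _ _ fun _ => rfl

lemma expect_signVal_mul_signVal {n : ℕ} {j l : Fin n} (hjl : j ≠ l) :
    𝔼 a : Fin n → ℤˣ, signVal (a j) * signVal (a l) = 0 := by
  have h := expect_comp_mul (Function.update 1 j (-1))
    (fun a : Fin n → ℤˣ => signVal (a j) * signVal (a l))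
  simp only [Pi.mul_apply, Function.update_self, Function.update_of_ne hjl.symm, Pi.one_apply,
    one_mul, neg_mul, signVal_neg, expect_neg_distrib] at h
  linarith

lemma expect_sq_sum_signVal {n : ℕ} (x : Fin n → ℝ) (i : Fin n) (J : Finset (Fin n)) :
    𝔼 a : Fin n → ℤˣ, (∑ j ∈ J, signVal (a i) * signVal (a j) * x j) ^ 2 = ∑ j ∈ J, x j ^ 2 := by
  have h1 : ∀ a : Fin n → ℤˣ, (∑ j ∈ J, signVal (a i) * signVal (a j) * x j) ^ 2
      = ∑ j ∈ J, ∑ l ∈ J, signVal (a j) * signVal (a l) * (x j * x l) := by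
    intro a
    rw [sq, sum_mul_sum]
    refine sum_congr rfl fun j _ => sum_congr rfl fun l _ => ?_
    have := signVal_mul_self (a i)
    linear_combination (signVal (a j) * signVal (a l) * (x j * x l)) * this
  simp only [h1]
  rw [expect_sum_comm]
  refine sum_congr rfl fun j hj => ?_
  rw [expect_sum_comm, sum_eq_single j]
  · simp [sq]
  · intro l _ hl
    rw [← expect_mul, expect_signVal_mul_signVal hl.symm, zero_mul]
  · exact fun h => absurd hj h

/-- The excess over one half of the probability of a strict upper tail of a symmetric random
variable. -/
lemma expect_upper_tail_eq {Ω : Type*} [Fintype Ω] [Nonempty Ω] (e : Ω → ℝ) (φ : Ω ≃ Ω)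
    (hφ : ∀ a, e (φ a) = -e a) {δ : ℝ} (hδ : 0 ≤ δ) :
    𝔼 a, ((if δ < e a then (1 : ℝ) else 0) - 1 / 2)
      = -(1 / 2) * 𝔼 a, (if |e a| ≤ δ then (1 : ℝ) else 0) := by
  have h1 : 𝔼 a, (if δ < e a then (1 : ℝ) else 0) = 𝔼 a, (if δ < -e a then (1 : ℝ) else 0) := by
    symm
    exact Fintype.expect_equiv φ _ _ fun a => by rw [hφ]
  have h2 : 𝔼 a, (if δ < e a then (1 : ℝ) else 0) + 𝔼 a, (if δ < -e a then (1 : ℝ) else 0)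
      + 𝔼 a, (if |e a| ≤ δ then (1 : ℝ) else 0) = 1 := by
    rw [← expect_add_distrib, ← expect_add_distrib]
    refine (expect_congr rfl fun a _ => ?_).trans (Fintype.expect_const (ι := Ω) (1 : ℝ))
    simp only [abs_le]
    split_ifs <;> first | norm_num; done | (exfalso; grind)
  rw [expect_sub_distrib, Fintype.expect_const]
  linarith

/-! ### The error of a single row -/

/-- The error of a single row, with hash function `h` and sign function `s`, as an estimate of the
`i`-th coordinate: the signed sum of the coordinates that collide with `i`. -/
def rowError {n C : ℕ} (x : Fin n → ℝ) (h : Fin n → Fin C) (s : Fin n → ℤˣ) (i : Fin n) : ℝ :=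
  ∑ j with j ≠ i ∧ h j = h i, signVal (s i) * signVal (s j) * x j

/-- The hash function obtained from `h` by moving to the twin column every coordinate `j` for which the
two signs of `g j` differ. -/
def flip {n C : ℕ} (h : Fin n → Fin C) (g : Fin n → ℤˣ × ℤˣ) : Fin n → Fin C :=
  fun j => if (g j).1 = (g j).2 then h j else twin (h j)

lemma flip_involutive {n C : ℕ} (g : Fin n → ℤˣ × ℤˣ) :
    Function.Involutive fun h : Fin n → Fin C => flip h g := by
  intro h
  ext j
  by_cases hj : (g j).1 = (g j).2 <;> simp [flip, hj, twin_involutive (h j)]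

@[simp] lemma pairIdx_flip {n C : ℕ} (h : Fin n → Fin C) (g : Fin n → ℤˣ × ℤˣ) (j : Fin n) :
    pairIdx (flip h g j) = pairIdx (h j) := by
  unfold flip
  split_ifs <;> simp [pairIdx_twin]

lemma expect_sign_pairs {n : ℕ} (f : (Fin n → ℤˣ) → (Fin n → ℤˣ) → ℝ) :
    𝔼 g : Fin n → ℤˣ × ℤˣ, f (fun j => (g j).1) (fun j => (g j).2) = 𝔼 a, 𝔼 b, f a b := by
  have h1 : 𝔼 g : Fin n → ℤˣ × ℤˣ, f (fun j => (g j).1) (fun j => (g j).2)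
      = 𝔼 z : (Fin n → ℤˣ) × (Fin n → ℤˣ), f z.1 z.2 :=
    Fintype.expect_equiv (Equiv.arrowProdEquivProdArrow (Fin n) (fun _ => ℤˣ) (fun _ => ℤˣ)) _ _
      fun g => rfl
  rw [h1, ← univ_product_univ, expect_product]

/-- The hash and sign functions of a row can be drawn by drawing a hash function and two independent
sign functions, of which the first one serves as the sign function and both together decide which
coordinates move to the twin column. -/
lemma expect_row_eq_expect_flip {n C : ℕ} [NeZero C] (F : (Fin n → Fin C) → (Fin n → ℤˣ) → ℝ) :
    𝔼 h, 𝔼 s, F h s = 𝔼 h, 𝔼 g : Fin n → ℤˣ × ℤˣ, F (flip h g) (fun j => (g j).1) := by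
  have h1 : ∀ h : Fin n → Fin C, 𝔼 s, F h s
      = 𝔼 g : Fin n → ℤˣ × ℤˣ, F h (fun j => (g j).1) := by
    intro h
    rw [expect_sign_pairs (fun a _ => F h a)]
    simp
  simp only [h1]
  rw [expect_comm, expect_comm univ univ (fun h g => F (flip h g) (fun j => (g j).1))]
  refine expect_congr rfl fun g _ => ?_
  symm
  exact Fintype.expect_bijective _ (flip_involutive g).bijective _ _ fun h => rfl

lemma rowError_flip_congr {n C : ℕ} (x : Fin n → ℝ) (h : Fin n → Fin C) (i : Fin n)
    (g g' : Fin n → ℤˣ × ℤˣ) (hg : ∀ j, pairIdx (h j) = pairIdx (h i) → g j = g' j) :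
    rowError x (flip h g) (fun j => (g j).1) i = rowError x (flip h g') (fun j => (g' j).1) i := by
  unfold rowError
  have hfl : ∀ j, pairIdx (h j) = pairIdx (h i) → flip h g j = flip h g' j := by
    intro j hj
    simp [flip, hg j hj]
  have hp : ∀ g : Fin n → ℤˣ × ℤˣ, ∀ j, flip h g j = flip h g i → pairIdx (h j) = pairIdx (h i) := by
    intro g j hj
    rw [← pairIdx_flip h g j, hj, pairIdx_flip]
  refine sum_congr ?_ fun j hj => ?_
  · ext j
    simp only [mem_filter, mem_univ, true_and]
    refine and_congr_right fun _ => ⟨fun hj => ?_, fun hj => ?_⟩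
    · rw [← hfl j (hp _ _ hj), ← hfl i rfl, hj]
    · rw [hfl j (hp _ _ hj), hfl i rfl, hj]
  · simp only [mem_filter, mem_univ, true_and] at hj
    simp only [hg j (hp _ _ hj.2), hg i rfl]

/-- The signs that are `-1` at `i` and `1` elsewhere. -/
def negAt {n : ℕ} (i : Fin n) : Fin n → ℤˣ × ℤˣ := fun j => if j = i then (-1, -1) else 1

/-- Negating both signs of the coordinate `i` keeps its column and negates its error. -/
lemma rowError_flip_neg {n C : ℕ} (x : Fin n → ℝ) (h : Fin n → Fin C) (i : Fin n)
    (g : Fin n → ℤˣ × ℤˣ) :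
    rowError x (flip h (negAt i * g))
      (fun j => ((negAt i * g) j).1) i
      = -rowError x (flip h g) (fun j => (g j).1) i := by
  have hfl : flip h (negAt i * g) = flip h g := by
    ext j
    by_cases hj : j = i
    · subst hj; simp [flip, negAt]
    · simp [flip, negAt, hj]
  unfold rowError
  rw [hfl, ← sum_neg_distrib]
  refine sum_congr rfl fun j hj => ?_
  simp only [mem_filter, mem_univ, true_and] at hj
  simp [negAt, hj.1]

/-- Within a pair of two distinct columns, the error is the mean of two independent copies of the same
Rademacher sum over the coordinates hashed to the pair. -/
lemma rowError_flip_eq {n C : ℕ} (x : Fin n → ℝ) (h : Fin n → Fin C) (i : Fin n)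
    (hi : twin (h i) ≠ h i) (a b : Fin n → ℤˣ) :
    rowError x (flip h fun j => (a j, b j)) a i =
      ((∑ j with j ≠ i ∧ pairIdx (h j) = pairIdx (h i), signVal (a i) * signVal (a j) * x j) +
        ∑ j with j ≠ i ∧ pairIdx (h j) = pairIdx (h i),
          signVal (b i) * signVal ((if h j = h i then 1 else -1) * b j) * x j) / 2 := by
  have hsub : rowError x (flip h fun j => (a j, b j)) a i =
      ∑ j with j ≠ i ∧ pairIdx (h j) = pairIdx (h i),
        if flip h (fun j => (a j, b j)) j = flip h (fun j => (a j, b j)) i then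
          signVal (a i) * signVal (a j) * x j else 0 := by
    unfold rowError
    rw [← sum_filter, filter_filter]
    refine sum_congr ?_ fun _ _ => rfl
    ext j
    simp only [mem_filter, mem_univ, true_and]
    constructor
    · rintro ⟨h1, h2⟩
      refine ⟨⟨h1, ?_⟩, h2⟩
      rw [← pairIdx_flip h (fun j => (a j, b j)) j, h2, pairIdx_flip]
    · rintro ⟨⟨h1, _⟩, h2⟩
      exact ⟨h1, h2⟩
  rw [hsub, ← sum_add_distrib, sum_div]
  refine sum_congr rfl fun j hj => ?_
  simp only [mem_filter, mem_univ, true_and] at hj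
  have hinv := twin_involutive (h i)
  rcases (pairIdx_eq_iff _ _).1 hj.2 with hji | hji <;>
  rcases Int.units_eq_one_or (a i) with h1 | h1 <;> rcases Int.units_eq_one_or (b i) with h2 | h2 <;>
  rcases Int.units_eq_one_or (a j) with h3 | h3 <;> rcases Int.units_eq_one_or (b j) with h4 | h4 <;>
  simp [flip, h1, h2, h3, h4, hji, hi, hi.symm, hinv]

/-- Conditionally on the pairs, the error of a row at `i` is at most `ε * σ` in absolute value with
probability at least `ε / 8`, if `i` is hashed to a pair of distinct columns in which the other
coordinates have squared norm at most `σ ^ 2`. -/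
lemma le_expect_abs_rowError_le {n C : ℕ} (x : Fin n → ℝ) (h : Fin n → Fin C) (i : Fin n)
    (hi : twin (h i) ≠ h i) {σ ε : ℝ} (hσ : 0 ≤ σ) (hε : 0 < ε) (hε1 : ε ≤ 1)
    (hx : ∑ j with j ≠ i ∧ pairIdx (h j) = pairIdx (h i), x j ^ 2 ≤ σ ^ 2) :
    ε / 8 ≤ 𝔼 g : Fin n → ℤˣ × ℤˣ,
      if |rowError x (flip h g) (fun j => (g j).1) i| ≤ ε * σ then (1 : ℝ) else 0 := by
  set J : Finset (Fin n) := {j | j ≠ i ∧ pairIdx (h j) = pairIdx (h i)} with hJ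
  let Y : (Fin n → ℤˣ) → ℝ := fun a => ∑ j ∈ J, signVal (a i) * signVal (a j) * x j
  have h1 := le_expect_abs_sub_le Y hσ hε hε1 (by
    rw [expect_sq_sum_signVal]; exact hx)
  refine h1.trans (le_of_eq ?_)
  rw [expect_sign_pairs (fun a b =>
    if |rowError x (flip h fun j => (a j, b j)) a i| ≤ ε * σ then (1 : ℝ) else 0)]
  refine expect_congr rfl fun a _ => ?_
  -- Multiplying `b` by these signs turns the sum of the two copies into a difference.
  let v : Fin n → ℤˣ := fun j => if j = i then -1 else if h j = h i then 1 else -1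
  rw [← expect_comp_mul v]
  refine expect_congr rfl fun b _ => ?_
  have h2 : Y a - Y (v * b) = 2 * rowError x (flip h fun j => (a j, b j)) a i := by
    rw [rowError_flip_eq x h i hi a b, mul_div_cancel₀ _ two_ne_zero, sub_eq_add_neg]
    congr 1
    simp only [Y]
    rw [← sum_neg_distrib]
    refine sum_congr rfl fun j hj => ?_
    have hji : j ≠ i := by
      simp only [mem_filter] at hj
      exact hj.2.1
    simp [v, hji]
  rw [h2, abs_mul, abs_two]
  simp only [mul_le_mul_iff_right₀ (zero_lt_two' ℝ)]

/-! ### The exponential moment of one row -/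

/-- The centred indicator of the event that the row error at `i`, multiplied by the sign `η`,
exceeds `δ`. -/
noncomputable def exceed {n C : ℕ} (x : Fin n → ℝ) (η : ℤˣ) (δ : ℝ) (h : Fin n → Fin C) (s : Fin n → ℤˣ)
    (i : Fin n) : ℝ :=
  (if δ < signVal η * rowError x h s i then (1 : ℝ) else 0) - 1 / 2

lemma abs_exceed {n C : ℕ} (x : Fin n → ℝ) (η : ℤˣ) (δ : ℝ) (h : Fin n → Fin C) (s : Fin n → ℤˣ)
    (i : Fin n) : |exceed x η δ h s i| = 1 / 2 := by
  unfold exceed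
  split_ifs <;> norm_num

lemma abs_signVal (u : ℤˣ) : |signVal u| = 1 := by
  rcases Int.units_eq_one_or u with rfl | rfl <;> simp

lemma expect_exceed_eq {n C : ℕ} (x : Fin n → ℝ) (η : ℤˣ) {δ : ℝ} (hδ : 0 ≤ δ)
    (h : Fin n → Fin C) (i : Fin n) :
    𝔼 g : Fin n → ℤˣ × ℤˣ, exceed x η δ (flip h g) (fun j => (g j).1) i =
      -(1 / 2) * 𝔼 g : Fin n → ℤˣ × ℤˣ,
        if |rowError x (flip h g) (fun j => (g j).1) i| ≤ δ then (1 : ℝ) else 0 := by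
  have := expect_upper_tail_eq
    (fun g : Fin n → ℤˣ × ℤˣ => signVal η * rowError x (flip h g) (fun j => (g j).1) i)
    (Equiv.mulLeft (negAt i)) (fun g => by
      simp only [Equiv.coe_mulLeft]
      rw [rowError_flip_neg, mul_neg]) hδ
  simpa only [exceed, abs_mul, abs_signVal, one_mul] using this

/-- The coordinate `i` is isolated if it is hashed to a pair of distinct columns that receives total
weight less than one from the other coordinates. -/
def Isolated {n C : ℕ} (w : Fin n → ℝ) (h : Fin n → Fin C) (i : Fin n) : Prop :=
  twin (h i) ≠ h i ∧ ∑ j with j ≠ i ∧ pairIdx (h j) = pairIdx (h i), w j < 1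

open Classical in
/-- By Markov's inequality, every coordinate is isolated with probability at least one half. -/
lemma half_le_expect_isolated {n C : ℕ} [NeZero C] (w : Fin n → ℝ) (hw : ∀ j, 0 ≤ w j)
    (hC : 2 * (1 + 2 * ∑ j, w j) ≤ C) (i : Fin n) :
    1 / 2 ≤ 𝔼 h : Fin n → Fin C, if Isolated w h i then (1 : ℝ) else 0 := by
  have hCpos : (0 : ℝ) < C := by exact_mod_cast Nat.pos_of_ne_zero (NeZero.ne C)
  have h1 : ∀ h : Fin n → Fin C, 1 - (if Isolated w h i then (1 : ℝ) else 0) ≤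
      (if twin (h i) = h i then (1 : ℝ) else 0) +
        ∑ j with j ≠ i, w j * (if pairIdx (h j) = pairIdx (h i) then 1 else 0) := by
    intro h
    have h0 : ∑ j with j ≠ i, w j * (if pairIdx (h j) = pairIdx (h i) then (1 : ℝ) else 0)
        = ∑ j with j ≠ i ∧ pairIdx (h j) = pairIdx (h i), w j := by
      simp only [mul_ite, mul_one, mul_zero]
      rw [← sum_filter, filter_filter]
    rw [h0]
    have hnn : 0 ≤ ∑ j with j ≠ i ∧ pairIdx (h j) = pairIdx (h i), w j :=
      sum_nonneg fun j _ => hw j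
    by_cases ht : twin (h i) = h i
    · simp only [ht, if_true]
      split_ifs <;> linarith
    · simp only [ht, if_false, Isolated, ne_eq, not_false_eq_true, true_and]
      split_ifs with h2
      · linarith
      · simp only [ne_eq] at *
        linarith
  have h2 := expect_le_expect (s := univ) fun h _ => h1 h
  rw [expect_sub_distrib, Fintype.expect_const, expect_add_distrib, expect_sum_comm] at h2
  have h3 : ∑ j with j ≠ i, 𝔼 h : Fin n → Fin C,
      w j * (if pairIdx (h j) = pairIdx (h i) then 1 else 0) ≤ ∑ j, w j * (2 / C) := by
    refine (sum_le_sum fun j hj => ?_).trans (sum_le_sum_of_subset_of_nonneg (subset_univ _)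
      fun j _ _ => mul_nonneg (hw j) (by positivity))
    rw [← mul_expect]
    exact mul_le_mul_of_nonneg_left (expect_pairIdx_eq_le (by simpa using hj)) (hw j)
  have h4 := expect_twin_eq_self_le (C := C) i
  rw [← sum_mul] at h3
  have h5 : 1 / (C : ℝ) + (∑ j, w j) * (2 / C) ≤ 1 / 2 := by
    rw [← mul_div_assoc, ← add_div, div_le_iff₀ hCpos]
    linarith
  linarith

/-- The sum of `l i * l j` over the ordered pairs of distinct coordinates in `T` that are hashed to the
same pair of columns. -/
def interaction {n C : ℕ} (T : Finset (Fin n)) (l : Fin n → ℝ) (h : Fin n → Fin C) : ℝ :=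
  ∑ i ∈ T, ∑ j ∈ T with j ≠ i, l i * l j * (if pairIdx (h j) = pairIdx (h i) then 1 else 0)

lemma sum_sq_fiber_eq {n C : ℕ} (T : Finset (Fin n)) (l : Fin n → ℝ) (h : Fin n → Fin C) :
    ∑ c ∈ T.image fun i => pairIdx (h i), (∑ i ∈ T with pairIdx (h i) = c, l i) ^ 2 =
      ∑ i ∈ T, l i ^ 2 + interaction T l h := by
  have h1 : ∀ c, (∑ i ∈ T with pairIdx (h i) = c, l i) ^ 2 =
      ∑ i ∈ T with pairIdx (h i) = c, ∑ j ∈ T,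
        l i * l j * (if pairIdx (h j) = pairIdx (h i) then 1 else 0) := by
    intro c
    rw [sq, sum_mul_sum]
    refine sum_congr rfl fun i hi => ?_
    rw [sum_filter]
    refine sum_congr rfl fun j _ => ?_
    rw [(mem_filter.1 hi).2]
    split_ifs <;> simp
  simp only [h1]
  rw [sum_fiberwise_of_maps_to (fun i hi => mem_image_of_mem _ hi), interaction, ← sum_add_distrib]
  refine sum_congr rfl fun i hi => ?_
  rw [filter_ne', ← add_sum_erase T _ hi]
  simp [sq]

open Classical in
/-- Conditionally on the pairs of columns, distinct pairs are independent, and every isolated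
coordinate contributes a saving. -/
lemma expect_flip_exp_le {n C : ℕ} (x : Fin n → ℝ) {σ : ℝ} (hσ : 0 ≤ σ)
    (T : Finset (Fin n)) (η : Fin n → ℤˣ) (ε : Fin n → ℝ) (hε : ∀ i ∈ T, 0 < ε i ∧ ε i ≤ 1)
    (w : Fin n → ℝ) (hw : ∀ j, 0 ≤ w j) (hwT : ∀ j ∈ T, 1 ≤ w j)
    (hwx : ∀ j, w j < 1 → x j ^ 2 ≤ w j * σ ^ 2) (h : Fin n → Fin C) :
    𝔼 g : Fin n → ℤˣ × ℤˣ, Real.exp (∑ i ∈ T, ε i / 60 *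
        exceed x (η i) (ε i * σ) (flip h g) (fun j => (g j).1) i) ≤
      Real.exp ((∑ i ∈ T, (ε i / 60) ^ 2 + interaction T (fun i => ε i / 60) h) / 8 -
        ∑ i ∈ T, if Isolated w h i then ε i ^ 2 / 1200 else 0) := by
  let F : ℕ → (Fin n → ℤˣ × ℤˣ) → ℝ := fun c g => ∑ i ∈ T with pairIdx (h i) = c,
    ε i / 60 * exceed x (η i) (ε i * σ) (flip h g) (fun j => (g j).1) i
  have hF : ∀ c g g', (∀ j, pairIdx (h j) = c → g j = g' j) → F c g = F c g' := by
    intro c g g' hg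
    refine sum_congr rfl fun i hi => ?_
    unfold exceed
    rw [rowError_flip_congr x h i g g' fun j hj => hg j (hj.trans (mem_filter.1 hi).2)]
  have hsplit : ∀ g : Fin n → ℤˣ × ℤˣ, Real.exp (∑ i ∈ T, ε i / 60 *
        exceed x (η i) (ε i * σ) (flip h g) (fun j => (g j).1) i)
      = ∏ c ∈ T.image fun i => pairIdx (h i), Real.exp (F c g) := by
    intro g
    rw [← Real.exp_sum]
    congr 1
    exact (sum_fiberwise_of_maps_to (fun i hi => mem_image_of_mem _ hi) _).symm
  simp only [hsplit]
  rw [expect_prod_of_disjoint_support (fun j => pairIdx (h j)) (fun c g => Real.exp (F c g))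
    (fun c g g' hg => by rw [hF c g g' hg])]
  rw [← sum_sq_fiber_eq, ← sum_fiberwise_of_maps_to (s := T)
    (fun i hi => mem_image_of_mem (fun i => pairIdx (h i)) hi) (fun i =>
      if Isolated w h i then ε i ^ 2 / 1200 else 0), sum_div, ← sum_sub_distrib, Real.exp_sum]
  refine prod_le_prod (fun c _ => expect_nonneg fun g _ => (Real.exp_pos _).le) fun c _ => ?_
  set L := ∑ i ∈ T with pairIdx (h i) = c, ε i / 60 with hL
  have hL0 : 0 ≤ L := sum_nonneg fun i hi => by
    have := (hε i (mem_filter.1 hi).1).1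
    positivity
  have hmean : 𝔼 g, F c g = ∑ i ∈ T with pairIdx (h i) = c, ε i / 60 *
      𝔼 g : Fin n → ℤˣ × ℤˣ, exceed x (η i) (ε i * σ) (flip h g) (fun j => (g j).1) i := by
    simp only [F]
    rw [expect_sum_comm]
    simp only [mul_expect]
  have hneg : ∀ i ∈ T, ε i / 60 * 𝔼 g : Fin n → ℤˣ × ℤˣ,
      exceed x (η i) (ε i * σ) (flip h g) (fun j => (g j).1) i ≤ 0 := by
    intro i hi
    have h0 := (hε i hi).1
    rw [expect_exceed_eq x (η i) (by positivity)]
    have : 0 ≤ 𝔼 g : Fin n → ℤˣ × ℤˣ,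
        if |rowError x (flip h g) (fun j => (g j).1) i| ≤ ε i * σ then (1 : ℝ) else 0 :=
      expect_nonneg fun g _ => by split_ifs <;> norm_num
    exact mul_nonpos_of_nonneg_of_nonpos (by positivity) (by linarith)
  have hbound : 𝔼 g, Real.exp (F c g) ≤ Real.exp (L ^ 2 / 8) + 𝔼 g, F c g := by
    have := expect_exp_le (F c) (r := L / 2) (by positivity) (fun g => by
      refine (abs_sum_le_sum_abs _ _).trans ?_
      rw [hL, sum_div]
      refine sum_le_sum fun i hi => ?_
      have h0 := (hε i (mem_filter.1 hi).1).1
      rw [abs_mul, abs_exceed, abs_of_pos (by positivity)]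
      exact le_of_eq (by ring)) (by
      rw [hmean]
      exact sum_nonpos fun i hi => hneg i (mem_filter.1 hi).1)
    convert this using 3
    ring
  refine hbound.trans ?_
  by_cases hiso : ∃ i ∈ T, pairIdx (h i) = c ∧ Isolated w h i
  · obtain ⟨i, hiT, hic, hi⟩ := hiso
    obtain ⟨h0, h01⟩ := hε i hiT
    -- The weight of a second element of `T` in the pair would contradict isolation.
    have hone : ({j ∈ T | pairIdx (h j) = c} : Finset (Fin n)) = {i} := by
      ext j
      simp only [mem_filter, mem_singleton]
      constructor
      · rintro ⟨hjT, hjc⟩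
        by_contra hji
        have : w j ≤ ∑ j with j ≠ i ∧ pairIdx (h j) = pairIdx (h i), w j :=
          single_le_sum (f := w) (fun j _ => hw j) (by simp [hji, hjc, hic])
        linarith [hi.2, hwT j hjT]
      · rintro rfl
        exact ⟨hiT, hic⟩
    have hx2 : ∑ j with j ≠ i ∧ pairIdx (h j) = pairIdx (h i), x j ^ 2 ≤ σ ^ 2 := by
      calc ∑ j with j ≠ i ∧ pairIdx (h j) = pairIdx (h i), x j ^ 2
          ≤ ∑ j with j ≠ i ∧ pairIdx (h j) = pairIdx (h i), w j * σ ^ 2 := by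
            refine sum_le_sum fun j hj => hwx j ?_
            have : w j ≤ ∑ j with j ≠ i ∧ pairIdx (h j) = pairIdx (h i), w j :=
              single_le_sum (f := w) (fun j _ => hw j) hj
            exact this.trans_lt hi.2
        _ ≤ 1 * σ ^ 2 := by
            rw [← sum_mul]
            exact mul_le_mul_of_nonneg_right hi.2.le (sq_nonneg σ)
        _ = σ ^ 2 := one_mul _
    have hsave := le_expect_abs_rowError_le x h i hi.1 hσ h0 h01 hx2
    have hm : 𝔼 g, F c g ≤ -(ε i ^ 2 / 960) := by
      rw [hmean, hone, sum_singleton, expect_exceed_eq x (η i) (by positivity)]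
      nlinarith
    have hLi : L = ε i / 60 := by rw [hL, hone, sum_singleton]
    rw [hone, sum_singleton, if_pos hi, hLi]
    have hu : Real.exp ((ε i / 60) ^ 2 / 8) ≤ 1.25 := by
      have h1 : (ε i / 60) ^ 2 / 8 ≤ 1 / 5 := by nlinarith
      have h2 := Real.exp_le_exp.2 h1
      have h3 := Real.add_one_le_exp (-(1 / 5 : ℝ))
      have h4 : Real.exp (1 / 5) * Real.exp (-(1 / 5)) = 1 := by
        rw [← Real.exp_add]; simp
      have h5 := Real.exp_pos (1 / 5)
      nlinarith
    have h6 := Real.add_one_le_exp (-(ε i ^ 2 / 1200))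
    rw [sub_eq_add_neg, Real.exp_add]
    have h7 := Real.exp_pos ((ε i / 60) ^ 2 / 8)
    have h8 := mul_le_mul_of_nonneg_left h6 h7.le
    have h9 := mul_le_mul_of_nonneg_right hu (by positivity : 0 ≤ ε i ^ 2 / 1200)
    linarith
  · have h0 : ∑ i ∈ T with pairIdx (h i) = c,
        (if Isolated w h i then ε i ^ 2 / 1200 else 0) = 0 :=
      sum_eq_zero fun i hi => if_neg fun hi' =>
        hiso ⟨i, (mem_filter.1 hi).1, (mem_filter.1 hi).2, hi'⟩
    rw [h0, sub_zero]
    have : 𝔼 g, F c g ≤ 0 := by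
      rw [hmean]
      exact sum_nonpos fun i hi => hneg i (mem_filter.1 hi).1
    linarith

/-- The exponential moment of the exceedances of a single row at the coordinates in `T`. The weights
`ε i / 60` make the quadratic cost of the exponential moment smaller than the savings, which are at
least `ε i ^ 2 / 1200` at isolated coordinates. The condition relating `#T` and `C` keeps the cost of
collisions inside `T` negligible: these have total probability of order `#T ^ 2 / C`, but can raise the
moment by a factor exponential in `#T`. -/
lemma expect_row_exp_le {n C : ℕ} [NeZero C] (x : Fin n → ℝ) {σ : ℝ} (hσ : 0 ≤ σ)
    (T : Finset (Fin n)) (η : Fin n → ℤˣ) (ε : Fin n → ℝ) (hε : ∀ i ∈ T, 0 < ε i ∧ ε i ≤ 1)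
    (hS : ∑ i ∈ T, ε i ^ 2 ≤ 1) (hTC : #T * Real.exp (#T * ∑ i ∈ T, ε i ^ 2) ≤ C)
    (w : Fin n → ℝ) (hw : ∀ j, 0 ≤ w j) (hwT : ∀ j ∈ T, 1 ≤ w j)
    (hwx : ∀ j, w j < 1 → x j ^ 2 ≤ w j * σ ^ 2) (hC : 2 * (1 + 2 * ∑ j, w j) ≤ C) :
    𝔼 h : Fin n → Fin C, 𝔼 s, Real.exp (∑ i ∈ T, ε i / 60 * exceed x (η i) (ε i * σ) h s i) ≤
      Real.exp (-(∑ i ∈ T, ε i ^ 2) / 10000) := by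
  classical
  have hCpos : (0 : ℝ) < C := by exact_mod_cast Nat.pos_of_ne_zero (NeZero.ne C)
  rw [expect_row_eq_expect_flip (fun h s =>
    Real.exp (∑ i ∈ T, ε i / 60 * exceed x (η i) (ε i * σ) h s i))]
  refine (expect_le_expect fun h _ => expect_flip_exp_le x hσ T η ε hε w hw hwT hwx h).trans ?_
  set S := ∑ i ∈ T, ε i ^ 2 with hSdef
  have hS0 : 0 ≤ S := sum_nonneg fun i _ => sq_nonneg _
  let D : (Fin n → Fin C) → ℝ := fun h => ∑ i ∈ T, if Isolated w h i then ε i ^ 2 / 1200 else 0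
  let Q : (Fin n → Fin C) → ℝ := fun h => interaction T (fun i => ε i / 60) h
  have hl : ∑ i ∈ T, (ε i / 60) ^ 2 = S / 3600 := by
    rw [hSdef, sum_div]; exact sum_congr rfl fun i _ => by ring
  have hl1 : (∑ i ∈ T, ε i / 60) ^ 2 ≤ #T * (S / 3600) := by
    rw [← hl]; exact sq_sum_le_card_mul_sum_sq
  have hlpos : ∀ i ∈ T, ∀ j ∈ T, 0 ≤ ε i / 60 * (ε j / 60) := fun i hi j hj => by
    have := (hε i hi).1
    have := (hε j hj).1
    positivity
  have hsq : ∑ i ∈ T, ∑ j ∈ T with j ≠ i, ε i / 60 * (ε j / 60) ≤ (∑ i ∈ T, ε i / 60) ^ 2 := by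
    rw [sq, sum_mul_sum]
    exact sum_le_sum fun i hi => sum_le_sum_of_subset_of_nonneg (filter_subset _ _)
      fun j hj _ => hlpos i hi j hj
  have hQ0 : ∀ h, 0 ≤ Q h := fun h => sum_nonneg fun i hi => sum_nonneg fun j hj =>
    mul_nonneg (hlpos i hi j (mem_filter.1 hj).1) (by split_ifs <;> norm_num)
  have hQ1 : ∀ h, Q h ≤ #T * (S / 3600) := fun h => by
    refine le_trans (sum_le_sum fun i hi => sum_le_sum fun j hj => ?_) (hsq.trans hl1)
    exact mul_le_of_le_one_right (hlpos i hi j (mem_filter.1 hj).1) (by split_ifs <;> norm_num)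
  have hEQ : 𝔼 h, Q h ≤ #T * (S / 3600) * (2 / C) := by
    have h1 : 𝔼 h, Q h ≤ ∑ i ∈ T, ∑ j ∈ T with j ≠ i, ε i / 60 * (ε j / 60) * (2 / C) := by
      simp only [Q, interaction]
      rw [expect_sum_comm]
      refine sum_le_sum fun i hi => ?_
      rw [expect_sum_comm]
      refine sum_le_sum fun j hj => ?_
      rw [← mul_expect]
      exact mul_le_mul_of_nonneg_left (expect_pairIdx_eq_le (mem_filter.1 hj).2)
        (hlpos i hi j (mem_filter.1 hj).1)
    refine h1.trans ?_
    simp only [← sum_mul]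
    exact mul_le_mul_of_nonneg_right (hsq.trans hl1) (by positivity)
  have hD0 : ∀ h, 0 ≤ D h := fun h => sum_nonneg fun i _ => by split_ifs <;> positivity
  have hD1 : ∀ h, D h ≤ 1 := fun h => by
    have : D h ≤ ∑ i ∈ T, ε i ^ 2 := sum_le_sum fun i _ => by
      split_ifs <;> nlinarith [sq_nonneg (ε i)]
    linarith
  have hED : S / 2400 ≤ 𝔼 h, D h := by
    simp only [D]
    rw [expect_sum_comm, hSdef, sum_div]
    refine sum_le_sum fun i _ => ?_
    have h1 := half_le_expect_isolated w hw hC i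
    have h2 : 𝔼 h : Fin n → Fin C, (if Isolated w h i then ε i ^ 2 / 1200 else 0)
        = ε i ^ 2 / 1200 * 𝔼 h : Fin n → Fin C, (if Isolated w h i then (1 : ℝ) else 0) := by
      rw [mul_expect]; simp
    rw [h2]
    nlinarith [sq_nonneg (ε i)]
  -- Both factors are linearized, `exp (-D) ≤ 1 - D / 2` and `exp (Q / 8) ≤ 1 + Q / 8 * exp (Q / 8)`,
  -- so that only the means of `D` and `Q` matter.
  have hpoint : ∀ h, Real.exp ((S / 3600 + Q h) / 8 - D h) ≤ Real.exp (S / 28800) *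
      ((1 - D h / 2) + Q h * (Real.exp (#T * S) / 8)) := by
    intro h
    have e1 : (S / 3600 + Q h) / 8 - D h = S / 28800 + (Q h / 8 + -D h) := by ring
    rw [e1, Real.exp_add]
    refine mul_le_mul_of_nonneg_left ?_ (Real.exp_pos _).le
    have hd : Real.exp (-D h) ≤ 1 - D h / 2 := by
      have h1 := Real.add_one_le_exp (D h)
      have h2 : Real.exp (D h) * Real.exp (-D h) = 1 := by rw [← Real.exp_add]; simp
      have h3 := Real.exp_pos (-D h)
      have h4 := hD0 h
      have h5 := hD1 h
      have h6 : (D h + 1) * Real.exp (-D h) ≤ 1 := by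
        exact (mul_le_mul_of_nonneg_right h1 h3.le).trans h2.le
      by_contra hcon
      push Not at hcon
      nlinarith
    have hq : Real.exp (Q h / 8) ≤ 1 + Q h / 8 * Real.exp (Q h / 8) := by
      have h1 := Real.add_one_le_exp (-(Q h / 8))
      have h2 : Real.exp (Q h / 8) * Real.exp (-(Q h / 8)) = 1 := by rw [← Real.exp_add]; simp
      nlinarith [Real.exp_pos (Q h / 8)]
    have hqe : Real.exp (Q h / 8) ≤ Real.exp (#T * S) := by
      refine Real.exp_le_exp.2 ?_
      have := hQ1 h
      have : 0 ≤ #T * S := by positivity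
      linarith
    have hd1 : Real.exp (-D h) ≤ 1 := Real.exp_le_one_iff.2 (by linarith [hD0 h])
    have hqn : 0 ≤ Q h / 8 * Real.exp (Q h / 8) := mul_nonneg (by linarith [hQ0 h]) (Real.exp_pos _).le
    rw [Real.exp_add]
    calc Real.exp (Q h / 8) * Real.exp (-D h)
        ≤ (1 + Q h / 8 * Real.exp (Q h / 8)) * Real.exp (-D h) :=
          mul_le_mul_of_nonneg_right hq (Real.exp_pos _).le
      _ ≤ Real.exp (-D h) + Q h / 8 * Real.exp (Q h / 8) := by nlinarith
      _ ≤ (1 - D h / 2) + Q h / 8 * Real.exp (#T * S) :=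
          add_le_add hd (mul_le_mul_of_nonneg_left hqe (by linarith [hQ0 h]))
      _ = _ := by ring
  have hsum : 𝔼 h : Fin n → Fin C, Real.exp ((∑ i ∈ T, (ε i / 60) ^ 2 +
      interaction T (fun i => ε i / 60) h) / 8 -
        ∑ i ∈ T, if Isolated w h i then ε i ^ 2 / 1200 else 0) ≤
      Real.exp (S / 28800) * ((1 - (𝔼 h, D h) / 2) + (𝔼 h, Q h) * (Real.exp (#T * S) / 8)) := by
    rw [hl]
    refine (expect_le_expect fun h _ => hpoint h).trans (le_of_eq ?_)
    rw [← mul_expect, expect_add_distrib, expect_sub_distrib, Fintype.expect_const, ← expect_div,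
      ← expect_mul]
  refine hsum.trans ?_
  have h1 : (𝔼 h, Q h) * (Real.exp (#T * S) / 8) ≤ S / 14400 := by
    have h2 : (𝔼 h, Q h) * (Real.exp (#T * S) / 8) ≤
        #T * (S / 3600) * (2 / C) * (Real.exp (#T * S) / 8) :=
      mul_le_mul_of_nonneg_right hEQ (by positivity)
    have h3 : #T * (S / 3600) * (2 / C) * (Real.exp (#T * S) / 8)
        = S / 14400 * ((#T * Real.exp (#T * S)) / C) := by field_simp; ring
    have h4 : (#T * Real.exp (#T * S)) / (C : ℝ) ≤ 1 := (div_le_one hCpos).2 hTC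
    rw [h3] at h2
    have := mul_le_mul_of_nonneg_left h4 (by positivity : 0 ≤ S / 14400)
    linarith
  have h2 : (1 - (𝔼 h, D h) / 2) + (𝔼 h, Q h) * (Real.exp (#T * S) / 8) ≤
      Real.exp (-(S / 7200)) := by
    have := Real.add_one_le_exp (-(S / 7200))
    linarith
  refine (mul_le_mul_of_nonneg_left h2 (Real.exp_pos _).le).trans ?_
  rw [← Real.exp_add]
  exact Real.exp_le_exp.2 (by linarith)

/-! ### From rows to the median -/

lemma le_two_mul_card_of_lt_median {R : ℕ} (a : Fin R → ℝ) {δ : ℝ} (h : δ < median a) :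
    R ≤ 2 * #{u | δ < a u} := by
  rcases Nat.eq_zero_or_pos R with rfl | hR
  · simp
  have hmono : Monotone (a ∘ Tuple.sort a) := Tuple.monotone_sort a
  have hmid : δ < a (Tuple.sort a ⟨R / 2, by omega⟩) := by
    rw [median, dif_pos hR] at h
    have : a (Tuple.sort a ⟨(R - 1) / 2, by omega⟩) ≤ a (Tuple.sort a ⟨R / 2, by omega⟩) :=
      hmono (Fin.mk_le_mk.2 (by omega))
    linarith
  have hsub : (Finset.Ici (⟨R / 2, by omega⟩ : Fin R)).map (Tuple.sort a).toEmbedding ⊆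
      ({u | δ < a u} : Finset (Fin R)) := by
    intro u hu
    obtain ⟨m, hm, rfl⟩ := mem_map.1 hu
    simp only [mem_filter, mem_univ, true_and]
    exact hmid.trans_le (hmono (Finset.mem_Ici.1 hm))
  have hcard := card_le_card hsub
  rw [card_map, Fin.card_Ici] at hcard
  simp only at hcard
  omega

lemma le_two_mul_card_of_median_lt {R : ℕ} (a : Fin R → ℝ) {δ : ℝ} (h : median a < δ) :
    R ≤ 2 * #{u | a u < δ} := by
  rcases Nat.eq_zero_or_pos R with rfl | hR
  · simp
  have hmono : Monotone (a ∘ Tuple.sort a) := Tuple.monotone_sort a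
  have hmid : a (Tuple.sort a ⟨(R - 1) / 2, by omega⟩) < δ := by
    rw [median, dif_pos hR] at h
    have : a (Tuple.sort a ⟨(R - 1) / 2, by omega⟩) ≤ a (Tuple.sort a ⟨R / 2, by omega⟩) :=
      hmono (Fin.mk_le_mk.2 (by omega))
    linarith
  have hsub : (Finset.Iic (⟨(R - 1) / 2, by omega⟩ : Fin R)).map (Tuple.sort a).toEmbedding ⊆
      ({u | a u < δ} : Finset (Fin R)) := by
    intro u hu
    obtain ⟨m, hm, rfl⟩ := mem_map.1 hu
    simp only [mem_filter, mem_univ, true_and]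
    exact (hmono (Finset.mem_Iic.1 hm)).trans_lt hmid
  have hcard := card_le_card hsub
  rw [card_map, Fin.card_Iic] at hcard
  simp only at hcard
  omega

lemma signVal_mul_sketch_eq {n R C : ℕ} (ω : Hashing n R C) (x : Fin n → ℝ) (u : Fin R)
    (i : Fin n) :
    signVal (ω.2 u i) * sketch ω x u (ω.1 u i) = x i + rowError x (ω.1 u) (ω.2 u) i := by
  have h1 : sketch ω x u (ω.1 u i) = signVal (ω.2 u i) * x i +
      ∑ j with j ≠ i ∧ ω.1 u j = ω.1 u i, signVal (ω.2 u j) * x j := by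
    have h2 : ({j | ω.1 u j = ω.1 u i} : Finset (Fin n)) =
        insert i ({j | j ≠ i ∧ ω.1 u j = ω.1 u i} : Finset (Fin n)) := by
      ext j
      simp only [mem_filter, mem_univ, true_and, mem_insert]
      by_cases h : j = i <;> simp [h]
    rw [sketch, h2, sum_insert (by simp)]
    rfl
  rw [h1, mul_add, ← mul_assoc, signVal_mul_self, one_mul, mul_sum, rowError]
  congr 1
  exact sum_congr rfl fun j _ => by ring

/-- If the median is off by more than `δ` in the direction `η`, then so are half of the rows. -/
lemma sum_exceed_nonneg {n R C : ℕ} (ω : Hashing n R C) (x : Fin n → ℝ) (i : Fin n) (η : ℤˣ) {δ : ℝ}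
    (h : δ < signVal η * (estimate ω x i - x i)) :
    0 ≤ ∑ u, exceed x η δ (ω.1 u) (ω.2 u) i := by
  have hest : estimate ω x i = median fun u => x i + rowError x (ω.1 u) (ω.2 u) i := by
    unfold estimate
    congr 1
    ext u
    exact signVal_mul_sketch_eq ω x u i
  have hR : R ≤ 2 * #{u | δ < signVal η * rowError x (ω.1 u) (ω.2 u) i} := by
    rw [hest] at h
    rcases Int.units_eq_one_or η with rfl | rfl
    · simp only [signVal_one, one_mul] at h ⊢
      have := le_two_mul_card_of_lt_median _ (lt_sub_iff_add_lt.1 h)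
      simpa only [add_comm δ, add_lt_add_iff_left] using this
    · simp only [signVal_neg, signVal_one, neg_mul, one_mul] at h ⊢
      have := le_two_mul_card_of_median_lt (fun u => x i + rowError x (ω.1 u) (ω.2 u) i)
        (δ := x i - δ) (by linarith)
      refine this.trans (Nat.mul_le_mul_left 2 (card_le_card fun u hu => ?_))
      simp only [mem_filter, mem_univ, true_and] at hu ⊢
      linarith
  have hR' : (R : ℝ) ≤ 2 * #{u | δ < signVal η * rowError x (ω.1 u) (ω.2 u) i} := by
    exact_mod_cast hR
  simp only [exceed, sum_sub_distrib, sum_const, card_univ, Fintype.card_fin, nsmul_eq_mul,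
    sum_boole]
  linarith

/-- The Chernoff bound for the event that the estimate at each `i ∈ T` is off by more than `ε i * σ` in
the prescribed direction `η i`. -/
lemma law_real_signed_deviation_le {n R C : ℕ} [NeZero C] (x : Fin n → ℝ) {σ : ℝ} (hσ : 0 ≤ σ)
    (T : Finset (Fin n)) (η : Fin n → ℤˣ) (ε : Fin n → ℝ) (hε : ∀ i ∈ T, 0 < ε i ∧ ε i ≤ 1)
    (hS : ∑ i ∈ T, ε i ^ 2 ≤ 1) (hTC : #T * Real.exp (#T * ∑ i ∈ T, ε i ^ 2) ≤ C)
    (w : Fin n → ℝ) (hw : ∀ j, 0 ≤ w j) (hwT : ∀ j ∈ T, 1 ≤ w j)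
    (hwx : ∀ j, w j < 1 → x j ^ 2 ≤ w j * σ ^ 2) (hC : 2 * (1 + 2 * ∑ j, w j) ≤ C) :
    (law n R C).real {ω | ∀ i ∈ T, ε i * σ < signVal (η i) * (estimate ω x i - x i)} ≤
      Real.exp (-(R * ∑ i ∈ T, ε i ^ 2) / 10000) := by
  classical
  let F : (Fin n → Fin C) → (Fin n → ℤˣ) → ℝ := fun h s =>
    Real.exp (∑ i ∈ T, ε i / 60 * exceed x (η i) (ε i * σ) h s i)
  rw [law_real_eq_expect]
  calc 𝔼 ω, (if ω ∈ {ω : Hashing n R C | ∀ i ∈ T, ε i * σ <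
          signVal (η i) * (estimate ω x i - x i)} then (1 : ℝ) else 0)
      ≤ 𝔼 ω : Hashing n R C, ∏ u, F (ω.1 u) (ω.2 u) := by
        refine expect_le_expect fun ω _ => ?_
        split_ifs with h
        · rw [← Real.exp_sum]
          refine Real.one_le_exp ?_
          rw [sum_comm]
          refine sum_nonneg fun i hi => ?_
          rw [← mul_sum]
          have := (hε i hi).1
          exact mul_nonneg (by positivity) (sum_exceed_nonneg ω x i (η i) (h i hi))
        · exact prod_nonneg fun u _ => (Real.exp_pos _).le
    _ = (𝔼 h, 𝔼 s, F h s) ^ R := expect_hashing_prod F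
    _ ≤ Real.exp (-(∑ i ∈ T, ε i ^ 2) / 10000) ^ R :=
        pow_le_pow_left₀ (expect_nonneg fun h _ => expect_nonneg fun s _ => (Real.exp_pos _).le)
          (expect_row_exp_le x hσ T η ε hε hS hTC w hw hwT hwx hC) R
    _ = _ := by
        rw [← Real.exp_nat_mul]
        congr 1
        ring

/-- Simultaneous deviations of the estimates at the coordinates in `T`: up to the number of sign
patterns, the tail is that of independent subgaussian errors of scale `σ / √R`. -/
lemma law_real_deviation_le {n R C : ℕ} [NeZero C] (x : Fin n → ℝ) {σ : ℝ} (hσ : 0 ≤ σ)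
    (T : Finset (Fin n)) (ε : Fin n → ℝ) (hε : ∀ i ∈ T, 0 < ε i ∧ ε i ≤ 1)
    (hS : ∑ i ∈ T, ε i ^ 2 ≤ 1) (hTC : #T * Real.exp (#T * ∑ i ∈ T, ε i ^ 2) ≤ C)
    (w : Fin n → ℝ) (hw : ∀ j, 0 ≤ w j) (hwT : ∀ j ∈ T, 1 ≤ w j)
    (hwx : ∀ j, w j < 1 → x j ^ 2 ≤ w j * σ ^ 2) (hC : 2 * (1 + 2 * ∑ j, w j) ≤ C) :
    (law n R C).real {ω | ∀ i ∈ T, ε i * σ < |estimate ω x i - x i|} ≤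
      2 ^ #T * Real.exp (-(R * ∑ i ∈ T, ε i ^ 2) / 10000) := by
  classical
  let η : Finset (Fin n) → Fin n → ℤˣ := fun U i => if i ∈ U then 1 else -1
  have hsub : {ω : Hashing n R C | ∀ i ∈ T, ε i * σ < |estimate ω x i - x i|} ⊆
      ⋃ U ∈ T.powerset, {ω | ∀ i ∈ T, ε i * σ < signVal (η U i) * (estimate ω x i - x i)} := by
    intro ω hω
    simp only [Set.mem_iUnion]
    refine ⟨{i ∈ T | 0 ≤ estimate ω x i - x i}, mem_powerset.2 (filter_subset _ _), fun i hi => ?_⟩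
    have h1 := hω i hi
    by_cases h : 0 ≤ estimate ω x i - x i
    · rw [abs_of_nonneg h] at h1
      simpa [η, hi, sub_nonneg.1 h] using h1
    · rw [abs_of_neg (not_le.1 h)] at h1
      rw [sub_nonneg] at h
      simpa [η, hi, h] using h1
  refine (MeasureTheory.measureReal_mono hsub (MeasureTheory.measure_ne_top _ _)).trans
    ((MeasureTheory.measureReal_biUnion_finset_le _ _).trans ?_)
  refine (sum_le_sum fun U _ => law_real_signed_deviation_le x hσ T (η U) ε hε hS hTC w hw hwT hwx
    hC).trans ?_
  rw [sum_const, card_powerset, nsmul_eq_mul]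
  push_cast
  exact le_rfl

/-! ### The top coordinates -/

/-- The position of the coordinate `i` in the list of coordinates by decreasing magnitude, starting
from `0`. -/
noncomputable def rank {n : ℕ} (x : Fin n → ℝ) (i : Fin n) : ℕ := ((bySize x).symm i : Fin n)

lemma head_apply {n : ℕ} (k : ℕ) (x : Fin n → ℝ) (i : Fin n) :
    head k x i = if rank x i < k then x i else 0 := rfl

lemma rank_injective {n : ℕ} (x : Fin n → ℝ) : Function.Injective (rank x) := fun _ _ h =>
  (bySize x).symm.injective (Fin.ext h)

lemma abs_le_abs_of_rank_le {n : ℕ} {x : Fin n → ℝ} {i j : Fin n} (h : rank x i ≤ rank x j) :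
    |x j| ≤ |x i| := by
  have h1 := Tuple.monotone_sort (fun i => -|x i|) (show (bySize x).symm i ≤ (bySize x).symm j from h)
  change -|x (bySize x ((bySize x).symm i))| ≤ -|x (bySize x ((bySize x).symm j))| at h1
  simpa using h1

lemma lt_of_rank_lt_of_abs_eq {n : ℕ} {x : Fin n → ℝ} {i j : Fin n} (h : rank x i < rank x j)
    (hx : |x i| = |x j|) : i < j := by
  have h1 := (Tuple.eq_sort_iff (f := fun i => -|x i|) (σ := bySize x)).1 rfl
  have h2 := h1.2 ((bySize x).symm i) ((bySize x).symm j) h (by simp [hx])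
  simpa using h2

lemma rank_lt_rank {n : ℕ} {x : Fin n → ℝ} {i j : Fin n}
    (h : |x j| < |x i| ∨ |x j| = |x i| ∧ i < j) : rank x i < rank x j := by
  by_contra hcon
  push Not at hcon
  have h1 := abs_le_abs_of_rank_le hcon
  rcases h with h | ⟨h, hij⟩
  · linarith
  · have h2 : rank x j < rank x i := lt_of_le_of_ne hcon fun he => hij.ne' (rank_injective x he)
    exact absurd (lt_of_rank_lt_of_abs_eq h2 h) hij.not_gt

lemma mag_le_abs {n : ℕ} {x : Fin n → ℝ} {m : ℕ} (hm : 1 ≤ m) {i : Fin n} (h : rank x i < m) :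
    mag x m ≤ |x i| := by
  unfold mag
  split_ifs with h1
  · refine abs_le_abs_of_rank_le ?_
    simp only [rank, Equiv.symm_apply_apply]
    unfold rank at h
    omega
  · exact abs_nonneg _

lemma abs_le_mag {n : ℕ} {x : Fin n → ℝ} {m : ℕ} {i : Fin n} (h : m ≤ rank x i + 1) :
    |x i| ≤ mag x m := by
  have h0 : rank x i < n := ((bySize x).symm i).2
  unfold mag
  rw [dif_pos (by omega)]
  refine abs_le_abs_of_rank_le ?_
  simp only [rank, Equiv.symm_apply_apply]
  unfold rank at h
  omega

lemma card_rank_lt {n : ℕ} (x : Fin n → ℝ) {m : ℕ} (hm : m ≤ n) : #{i | rank x i < m} = m := by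
  have : ({i | rank x i < m} : Finset (Fin n)).map
      ⟨rank x, rank_injective x⟩ = range m := by
    ext a
    simp only [mem_map, mem_filter, mem_univ, true_and, Function.Embedding.coeFn_mk, mem_range]
    constructor
    · rintro ⟨i, hi, rfl⟩
      exact hi
    · intro ha
      exact ⟨bySize x ⟨a, by omega⟩, by simpa [rank] using ha, by simp [rank]⟩
  rw [← card_map ⟨rank x, rank_injective x⟩, this, card_range]

/-- A set of `k` coordinates that precede all others consists of the `k` largest ones. -/
lemma filter_rank_lt_eq {n k : ℕ} {z : Fin n → ℝ} (hk : k ≤ n) {P : Finset (Fin n)} (hP : #P = k)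
    (h : ∀ i ∈ P, ∀ j ∉ P, rank z i < rank z j) : ({i | rank z i < k} : Finset (Fin n)) = P := by
  symm
  refine eq_of_subset_of_card_le (fun i hi => ?_) (by rw [card_rank_lt z hk, hP])
  simp only [mem_filter, mem_univ, true_and]
  by_contra hcon
  obtain ⟨j, hj, hjP⟩ : ∃ j ∈ ({i | rank z i < k} : Finset (Fin n)), j ∉ P.erase i := by
    refine exists_mem_notMem_of_card_lt_card ?_
    rw [card_rank_lt z hk, card_erase_of_mem hi, hP]
    have := card_pos.2 ⟨i, hi⟩
    omega
  simp only [mem_filter, mem_univ, true_and] at hj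
  have hji : j ≠ i := by rintro rfl; exact hcon hj
  have hjP' : j ∉ P := fun hh => hjP (mem_erase.2 ⟨hji, hh⟩)
  have := h i hi j hjP'
  omega

lemma l2norm_sq {n : ℕ} (v : Fin n → ℝ) : l2norm v ^ 2 = ∑ i, v i ^ 2 := by
  rw [l2norm, EuclideanSpace.norm_sq_eq]
  simp

lemma l2norm_nonneg {n : ℕ} (v : Fin n → ℝ) : 0 ≤ l2norm v := norm_nonneg _

lemma l2norm_tail_sq {n : ℕ} (k : ℕ) (x : Fin n → ℝ) :
    l2norm (tail k x) ^ 2 = ∑ i with ¬ rank x i < k, x i ^ 2 := by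
  rw [l2norm_sq, sum_filter]
  refine sum_congr rfl fun i _ => ?_
  by_cases h : rank x i < k <;> simp [tail, head_apply, h]

/-- If two vectors agree on the top `k` coordinates of the first, and elsewhere the second either
agrees with the first or is smaller in magnitude than all of these `k` coordinates, then both have
the same head. -/
lemma head_eq_of_dominated {n k : ℕ} (hk1 : 1 ≤ k) (hk : k ≤ n) (y z : Fin n → ℝ)
    (h1 : ∀ i, rank y i < k → z i = y i)
    (h2 : ∀ i, ¬ rank y i < k → z i = y i ∨ |z i| < mag y k) : head k z = head k y := by
  have hset : ({i | rank z i < k} : Finset (Fin n)) = ({i | rank y i < k} : Finset (Fin n)) := by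
    refine filter_rank_lt_eq hk (card_rank_lt y hk) fun i hi j hj => ?_
    simp only [mem_filter, mem_univ, true_and] at hi hj
    refine rank_lt_rank ?_
    rw [h1 i hi]
    rcases h2 j hj with h | h
    · rw [h]
      have hij : rank y i < rank y j := by omega
      rcases (abs_le_abs_of_rank_le hij.le).lt_or_eq with h3 | h3
      · exact Or.inl h3
      · exact Or.inr ⟨h3, lt_of_rank_lt_of_abs_eq hij h3.symm⟩
    · exact Or.inl (h.trans_le (mag_le_abs hk1 hi))
  ext i
  have hi : rank z i < k ↔ rank y i < k := by simpa using Finset.ext_iff.1 hset i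
  rw [head_apply, head_apply]
  by_cases h : rank y i < k
  · rw [if_pos (hi.2 h), if_pos h, h1 i h]
  · rw [if_neg (fun h' => h (hi.1 h')), if_neg h]

/-- If all coordinates of `y` are accurate up to a third of the gap between the `k`-th and the
`2k`-th largest magnitude of `x`, then the top-`k` error only involves the top `2k` coordinates of
`x`. -/
lemma topError_sq_le {n k : ℕ} (hk : 1 ≤ k) (hkn : 2 * k ≤ n) (x y : Fin n → ℝ)
    (hxy : ∀ i, |y i - x i| ≤ (mag x k - mag x (2 * k)) / 3) :
    topError k x y ^ 2 ≤ ∑ i with rank x i < 2 * k, (y i - x i) ^ 2 := by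
  have hnn : 0 ≤ topError k x y := Real.iInf_nonneg fun z => l2norm_nonneg _
  have hle : ∀ z : Fin n → ℝ, head k z = head k y → topError k x y ≤ l2norm (x - z) := fun z hz =>
    ciInf_le (f := fun z : {z : Fin n → ℝ // head k z = head k y} => l2norm (x - z.1))
      ⟨0, by rintro _ ⟨z, rfl⟩; exact l2norm_nonneg _⟩ ⟨z, hz⟩
  suffices hz : ∃ z : Fin n → ℝ, head k z = head k y ∧
      ∑ i, (x i - z i) ^ 2 ≤ ∑ i with rank x i < 2 * k, (y i - x i) ^ 2 by
    obtain ⟨z, hz, hs⟩ := hz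
    refine (pow_le_pow_left₀ hnn (hle z hz) 2).trans ?_
    rw [l2norm_sq]
    exact hs
  set G := mag x k - mag x (2 * k) with hG
  rcases le_or_gt G 0 with hG0 | hG0
  · have hyx : y = x := by
      ext i
      have h1 := hxy i
      have h2 := abs_nonneg (y i - x i)
      have h3 : |y i - x i| = 0 := by linarith
      linarith [abs_eq_zero.1 h3]
    subst hyx
    exact ⟨y, rfl, by simp⟩
  have hm : mag x k - G / 3 ≤ mag y k := by
    -- One of the top `k` coordinates of `x` is not among the top `k - 1` coordinates of `y`.
    obtain ⟨i, hi, hi'⟩ : ∃ i ∈ ({i | rank x i < k} : Finset (Fin n)),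
        i ∉ ({i | rank y i < k - 1} : Finset (Fin n)) := by
      refine exists_mem_notMem_of_card_lt_card ?_
      rw [card_rank_lt x (by omega), card_rank_lt y (by omega)]
      omega
    simp only [mem_filter, mem_univ, true_and] at hi hi'
    have h1 := mag_le_abs hk hi
    have h2 : |y i| ≤ mag y k := abs_le_mag (by omega)
    have h3 := abs_sub_abs_le_abs_sub (x i) (y i)
    rw [abs_sub_comm] at h3
    linarith [hxy i]
  -- A coordinate of `x` that would compete with the head of `y` is replaced by its estimate.
  refine ⟨fun i => if rank y i < k then y i else if |x i| < mag y k then x i else y i,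
    head_eq_of_dominated hk (by omega) y _ (fun i hi => if_pos hi) (fun i hi => ?_), ?_⟩
  · simp only [if_neg hi]
    split_ifs with h
    · exact Or.inr h
    · exact Or.inl rfl
  · rw [sum_filter]
    refine sum_le_sum fun i _ => ?_
    beta_reduce
    have hsmall : ¬ rank x i < 2 * k → |x i| ≤ mag x (2 * k) := fun h => abs_le_mag (by omega)
    by_cases hi : rank x i < 2 * k
    · rw [if_pos hi]
      split_ifs
      · exact le_of_eq (by ring)
      · rw [sub_self, zero_pow two_ne_zero]
        exact sq_nonneg _
      · exact le_of_eq (by ring)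
    · rw [if_neg hi]
      have h1 := hsmall hi
      have hy : ¬ rank y i < k := fun h => by
        have h2 := mag_le_abs hk h
        have h3 := abs_sub_abs_le_abs_sub (y i) (x i)
        linarith [hxy i]
      rw [if_neg hy, if_pos (by linarith)]
      simp

/-! ### Blocks of logarithmic size -/

lemma exists_mem_finsuppAntidiag_le {ι : Type*} [DecidableEq ι] (T : Finset ι) (m₀ : ι → ℕ) (p : ℕ)
    (h : p ≤ ∑ i ∈ T, m₀ i) : ∃ m ∈ T.finsuppAntidiag p, ∀ i, m i ≤ m₀ i := by
  induction p with
  | zero => exact ⟨0, by simp, by simp⟩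
  | succ p ih =>
    obtain ⟨m, hm, hle⟩ := ih (by omega)
    rw [mem_finsuppAntidiag] at hm
    obtain ⟨i, hi, hlt⟩ : ∃ i ∈ T, m i < m₀ i := by
      by_contra! hcon
      have : ∑ i ∈ T, m₀ i ≤ ∑ i ∈ T, m i := sum_le_sum hcon
      have h1 : ∑ i ∈ T, m i = p := hm.1
      omega
    refine ⟨m + Finsupp.single i 1, mem_finsuppAntidiag.2 ⟨?_, ?_⟩, fun j => ?_⟩
    · have h1 : ∑ j ∈ T, (m + Finsupp.single i 1 : ι →₀ ℕ) j
          = ∑ j ∈ T, m j + ∑ j ∈ T, (Finsupp.single i 1 : ι →₀ ℕ) j := by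
        rw [← sum_add_distrib]; rfl
      have h2 : ∑ j ∈ T, (Finsupp.single i 1 : ι →₀ ℕ) j = 1 := by
        rw [sum_eq_single i]
        · simp
        · intro j _ hj
          simp [hj.symm]
        · exact fun hh => absurd hi hh
      have h3 : ∑ i ∈ T, m i = p := hm.1
      exact h1.trans (by rw [h2, h3])
    · refine Finsupp.support_add.trans (union_subset hm.2 ?_)
      exact Finsupp.support_single_subset.trans (singleton_subset_iff.2 hi)
    · by_cases hj : i = j
      · subst hj
        simpa using hlt
      · simpa [Finsupp.single_apply, hj] using hle j

/-- If the sum of `z` over at most `p` indices exceeds `2 * B * p`, then `z` exceeds `B` times a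
vector of natural numbers of total exactly `p` wherever this vector does not vanish. -/
lemma exists_profile {ι : Type*} [DecidableEq ι] (T : Finset ι) (z : ι → ℝ) {B : ℝ} (hB : 0 < B)
    {p : ℕ} (hT : #T ≤ p) (hz : 2 * B * p < ∑ i ∈ T, z i) :
    ∃ m ∈ T.finsuppAntidiag p, ∀ i, m i ≠ 0 → B * m i < z i := by
  obtain ⟨m, hm, hle⟩ := exists_mem_finsuppAntidiag_le T (fun i => ⌈z i / B⌉₊ - 1) p (by
    have h1 : ∀ i, z i / B - 1 ≤ ((⌈z i / B⌉₊ - 1 : ℕ) : ℝ) := fun i => by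
      have h2 := Nat.le_ceil (z i / B)
      have h3 : ⌈z i / B⌉₊ ≤ (⌈z i / B⌉₊ - 1) + 1 := by omega
      have h4 : (⌈z i / B⌉₊ : ℝ) ≤ ((⌈z i / B⌉₊ - 1 : ℕ) : ℝ) + 1 := by exact_mod_cast h3
      linarith
    have h5 : ∑ i ∈ T, (z i / B - 1) ≤ ∑ i ∈ T, ((⌈z i / B⌉₊ - 1 : ℕ) : ℝ) :=
      sum_le_sum fun i _ => h1 i
    rw [sum_sub_distrib, ← sum_div, sum_const, nsmul_eq_mul, mul_one] at h5
    have h6 : 2 * (p : ℝ) < (∑ i ∈ T, z i) / B := by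
      rw [lt_div_iff₀ hB]; linarith
    have h7 : (#T : ℝ) ≤ p := by exact_mod_cast hT
    have h8 : (p : ℝ) ≤ ∑ i ∈ T, ((⌈z i / B⌉₊ - 1 : ℕ) : ℝ) := by linarith
    exact_mod_cast h8)
  refine ⟨m, hm, fun i hi => ?_⟩
  have h1 := hle i
  have h2 : m i < ⌈z i / B⌉₊ := by omega
  have h3 := (lt_div_iff₀ hB).1 (Nat.lt_ceil.1 h2)
  linarith

/-- The tail bound for simultaneous deviations, at the scale `σ = √(40 / C) * ‖tail‖` of a single
row. -/
lemma law_real_deviation_le_of_tail {n k R C p : ℕ} [NeZero C] (x : Fin n → ℝ) (hk : k ≤ n)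
    (hk1 : 1 ≤ k) {σ : ℝ} (hσ : 0 ≤ σ) (hσC : σ ^ 2 * C = 40 * l2norm (tail k x) ^ 2)
    (T : Finset (Fin n)) (hTp : #T ≤ p) (hC : 10 * ((k : ℝ) + p) ≤ C)
    (ε : Fin n → ℝ) (hε : ∀ i ∈ T, 0 < ε i ∧ ε i ≤ 1)
    (hS : ∑ i ∈ T, ε i ^ 2 ≤ 1) (hpC : p * Real.exp (p * ∑ i ∈ T, ε i ^ 2) ≤ C) :
    (law n R C).real {ω | ∀ i ∈ T, ε i * σ < |estimate ω x i - x i|} ≤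
      2 ^ #T * Real.exp (-(R * ∑ i ∈ T, ε i ^ 2) / 10000) := by
  classical
  have hT' : (#T : ℝ) ≤ p := by exact_mod_cast hTp
  have hS0 : 0 ≤ ∑ i ∈ T, ε i ^ 2 := sum_nonneg fun i _ => sq_nonneg _
  have hTC : #T * Real.exp (#T * ∑ i ∈ T, ε i ^ 2) ≤ C := by
    refine le_trans ?_ hpC
    gcongr
  -- For `σ = 0` the tail vanishes, and so do the quotients below.
  let w : Fin n → ℝ := fun j => if rank x j < k ∨ j ∈ T then 1 else x j ^ 2 / σ ^ 2
  have htail : ∑ i with ¬ rank x i < k, x i ^ 2 / σ ^ 2 ≤ C / 40 := by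
    rw [← sum_div, ← l2norm_tail_sq]
    rcases hσ.eq_or_lt with h | h
    · rw [← h]
      simp only [ne_eq, OfNat.ofNat_ne_zero, not_false_eq_true, zero_pow, div_zero]
      positivity
    · rw [div_le_div_iff₀ (by positivity) (by norm_num)]
      linarith
  have hw : ∀ j, 0 ≤ w j := fun j => by
    simp only [w]; split_ifs <;> positivity
  refine law_real_deviation_le x hσ T ε hε hS hTC w hw (fun j hj => by simp [w, hj])
    (fun j hj => ?_) ?_
  · have hj' : ¬ (rank x j < k ∨ j ∈ T) := fun h => by simp [w, h] at hj
    simp only [w, if_neg hj']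
    rcases hσ.eq_or_lt with h | h
    · rw [← h, zero_pow two_ne_zero, zero_mul] at hσC
      have h0 : ∑ i with ¬ rank x i < k, x i ^ 2 = 0 := by
        rw [← l2norm_tail_sq]; linarith
      have h1 := (sum_eq_zero_iff_of_nonneg fun i _ => sq_nonneg (x i)).1 h0 j
        (by simpa using fun hh => hj' (Or.inl hh))
      rw [h1]; simp
    · rw [div_mul_cancel₀ _ (by positivity)]
  · have hsum : ∑ j, w j ≤ k + p + C / 40 := by
      have h1 : ∀ j, w j ≤ (if rank x j < k then (1 : ℝ) else 0) + (if j ∈ T then 1 else 0) +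
          (if ¬ rank x j < k then x j ^ 2 / σ ^ 2 else 0) := by
        intro j
        have : 0 ≤ x j ^ 2 / σ ^ 2 := by positivity
        by_cases h1 : rank x j < k <;> by_cases h2 : j ∈ T <;> simp [w, h1, h2, this]
      refine (sum_le_sum fun j _ => h1 j).trans ?_
      rw [sum_add_distrib, sum_add_distrib, sum_boole, card_rank_lt x hk, sum_boole,
        ← sum_filter]
      have h2 : #({j | j ∈ T} : Finset (Fin n)) = #T := by simp
      rw [h2]
      linarith
    have : (1 : ℝ) ≤ k := by exact_mod_cast hk1
    have : (0 : ℝ) ≤ p := Nat.cast_nonneg p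
    linarith

/-- The squared error on a block of at most `p` coordinates is of the order `p * σ ^ 2 / R`, except
with probability exponentially small in `p`. -/
lemma law_real_block_le {n k R C p : ℕ} [NeZero C] (x : Fin n → ℝ) (hk : k ≤ n)
    (hk1 : 1 ≤ k) {σ : ℝ} (hσ : 0 < σ) (hσC : σ ^ 2 * C = 40 * l2norm (tail k x) ^ 2)
    (T : Finset (Fin n)) (hTp : #T ≤ p) (hC : 10 * ((k : ℝ) + p) ≤ C)
    (hR : 0 < R) (hpR : 40000 * (p : ℝ) ≤ R)
    (hpC : p * Real.exp (p * (40000 * p / R)) ≤ C) :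
    (law n R C).real {ω | 2 * 40000 * p * (σ ^ 2 / R) < ∑ i ∈ T, (estimate ω x i - x i) ^ 2} ≤
      Real.exp (-p) := by
  classical
  have hR' : (0 : ℝ) < R := by exact_mod_cast hR
  let ε : (Fin n →₀ ℕ) → Fin n → ℝ := fun m i => √(40000 * m i / R)
  have hεsq : ∀ m i, ε m i ^ 2 = 40000 * m i / R := fun m i => Real.sq_sqrt (by positivity)
  have hsub : {ω : Hashing n R C | 2 * 40000 * p * (σ ^ 2 / R) <
      ∑ i ∈ T, (estimate ω x i - x i) ^ 2} ⊆
      ⋃ m ∈ T.finsuppAntidiag p, {ω | ∀ i ∈ T.filter (fun i => m i ≠ 0),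
        ε m i * σ < |estimate ω x i - x i|} := by
    intro ω hω
    simp only [Set.mem_ofPred_eq] at hω
    obtain ⟨m, hm, hlt⟩ := exists_profile T
      (fun i => (estimate ω x i - x i) ^ 2 / (σ ^ 2 / R)) (B := 40000) (by norm_num) hTp (by
        rw [← sum_div, lt_div_iff₀ (by positivity)]; exact hω)
    simp only [Set.mem_iUnion]
    refine ⟨m, hm, fun i hi => ?_⟩
    have h1 := hlt i (mem_filter.1 hi).2
    rw [lt_div_iff₀ (by positivity)] at h1
    refine lt_of_pow_lt_pow_left₀ 2 (abs_nonneg _) ?_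
    rw [mul_pow, hεsq, sq_abs]
    refine lt_of_eq_of_lt ?_ h1
    ring
  refine (MeasureTheory.measureReal_mono hsub (MeasureTheory.measure_ne_top _ _)).trans
    ((MeasureTheory.measureReal_biUnion_finset_le _ _).trans ?_)
  have hterm : ∀ m ∈ T.finsuppAntidiag p, (law n R C).real
      {ω | ∀ i ∈ T.filter (fun i => m i ≠ 0), ε m i * σ < |estimate ω x i - x i|} ≤
      2 ^ p * Real.exp (-(4 * p)) := by
    intro m hm
    rw [mem_finsuppAntidiag] at hm
    have hsum : ∑ i ∈ T.filter (fun i => m i ≠ 0), ε m i ^ 2 = 40000 * p / R := by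
      rw [sum_filter_of_ne (p := fun i => m i ≠ 0) (f := fun i => ε m i ^ 2) (fun i _ h hm0 => h (by
        rw [hεsq, hm0]; simp))]
      simp only [hεsq]
      rw [← sum_div, ← mul_sum, ← hm.1]
      push_cast
      rfl
    have hle : ∀ i, m i ≤ p := fun i => by
      by_cases hi : i ∈ T
      · rw [← hm.1]
        exact single_le_sum (f := fun i => m i) (fun _ _ => Nat.zero_le _) hi
      · have : m i = 0 := by
          by_contra h
          exact hi (hm.2 (Finsupp.mem_support_iff.2 h))
        omega
    have hcard : #(T.filter (fun i => m i ≠ 0)) ≤ p := (card_filter_le _ _).trans hTp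
    refine (law_real_deviation_le_of_tail (p := p) x hk hk1 hσ.le hσC _ hcard hC (ε m)
      (fun i hi => ⟨?_, ?_⟩) ?_ ?_).trans ?_
    · have : 0 < m i := Nat.pos_of_ne_zero (mem_filter.1 hi).2
      have : (0 : ℝ) < m i := by exact_mod_cast this
      exact Real.sqrt_pos.2 (by positivity)
    · refine Real.sqrt_le_one.2 ?_
      have h1 : (m i : ℝ) ≤ p := by exact_mod_cast hle i
      rw [div_le_one hR']
      linarith
    · rw [hsum, div_le_one hR']
      exact hpR
    · rw [hsum]; exact hpC
    · rw [hsum, mul_div_cancel₀ _ hR'.ne']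
      have h1 : (2 : ℝ) ^ #(T.filter (fun i => m i ≠ 0)) ≤ 2 ^ p :=
        pow_le_pow_right₀ (by norm_num) hcard
      refine (mul_le_mul_of_nonneg_right h1 (Real.exp_pos _).le).trans (le_of_eq ?_)
      congr 2
      ring
  refine (sum_le_sum hterm).trans ?_
  have hcard : (#(T.finsuppAntidiag p) : ℝ) ≤ 4 ^ p := by
    have h1 : #(T.finsuppAntidiag p) ≤ 4 ^ p := by
      rw [card_finsuppAntidiag_nat_eq_choose]
      refine (Nat.choose_le_two_pow _ _).trans ?_
      rw [show (4 : ℕ) = 2 ^ 2 by norm_num, ← pow_mul]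
      exact Nat.pow_le_pow_right (by norm_num) (by omega)
    exact_mod_cast h1
  rw [sum_const, nsmul_eq_mul]
  have h8 : (8 : ℝ) ≤ Real.exp 3 := by
    have h1 := Real.exp_one_gt_d9
    have h2 : Real.exp 3 = Real.exp 1 ^ 3 := by rw [← Real.exp_nat_mul]; norm_num
    rw [h2]
    have h3 : (2.7 : ℝ) ^ 3 ≤ Real.exp 1 ^ 3 := pow_le_pow_left₀ (by norm_num) (by linarith) 3
    norm_num at h3
    linarith
  calc (#(T.finsuppAntidiag p) : ℝ) * (2 ^ p * Real.exp (-(4 * p)))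
      ≤ 4 ^ p * (2 ^ p * Real.exp (-(4 * p))) :=
        mul_le_mul_of_nonneg_right hcard (by positivity)
    _ = 8 ^ p * Real.exp (-(4 * p)) := by
        rw [← mul_assoc, ← mul_pow]; norm_num
    _ ≤ Real.exp 3 ^ p * Real.exp (-(4 * p)) := by gcongr
    _ = Real.exp (-p) := by
        rw [← Real.exp_nat_mul, ← Real.exp_add]
        congr 1
        ring

/-- All estimates are accurate up to the scale `σ` of a single row. -/
lemma law_real_exists_deviation_le {n k R C : ℕ} [NeZero C] (x : Fin n → ℝ) (hk : k ≤ n)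
    (hk1 : 1 ≤ k) {σ : ℝ} (hσ : 0 ≤ σ) (hσC : σ ^ 2 * C = 40 * l2norm (tail k x) ^ 2)
    (hC : 10 * ((k : ℝ) + 1) ≤ C) :
    (law n R C).real {ω | ∃ i, σ < |estimate ω x i - x i|} ≤
      n * (2 * Real.exp (-R / 10000)) := by
  have hsub : {ω : Hashing n R C | ∃ i, σ < |estimate ω x i - x i|} ⊆
      ⋃ i ∈ (univ : Finset (Fin n)), {ω | ∀ j ∈ ({i} : Finset (Fin n)),
        (fun _ => (1 : ℝ)) j * σ < |estimate ω x j - x j|} := by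
    rintro ω ⟨i, hi⟩
    simp only [Set.mem_iUnion]
    exact ⟨i, mem_univ i, by simpa using hi⟩
  refine (MeasureTheory.measureReal_mono hsub (MeasureTheory.measure_ne_top _ _)).trans
    ((MeasureTheory.measureReal_biUnion_finset_le _ _).trans ?_)
  have hterm : ∀ i : Fin n, (law n R C).real {ω | ∀ j ∈ ({i} : Finset (Fin n)),
      (fun _ => (1 : ℝ)) j * σ < |estimate ω x j - x j|} ≤ 2 * Real.exp (-R / 10000) := by
    intro i
    have h1 : (1 : ℝ) ≤ k := by exact_mod_cast hk1
    have h2 := law_real_deviation_le_of_tail (R := R) (p := 1) x hk hk1 hσ hσC {i} (by simp)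
      (by simpa using hC) (fun _ => 1) (fun _ _ => by norm_num) (by simp) (by
        have := Real.exp_one_lt_d9
        simp only [sum_singleton, Nat.cast_one, one_pow, mul_one, one_mul]
        linarith)
    simpa using h2
  refine (sum_le_sum fun i _ => hterm i).trans ?_
  simp

/-- A vector with small sums over consecutive blocks of `p` of the top `q` coordinates has a small sum
over all of them. -/
lemma sum_top_le_of_blocks {n p q : ℕ} (x z : Fin n → ℝ) {M : ℝ} (hM : 0 ≤ M)
    (h : ∀ b, ∑ i with rank x i < q ∧ rank x i / p = b, z i ≤ M * p) :
    ∑ i with rank x i < q, z i ≤ M * (q + p) := by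
  have hmaps : ∀ i ∈ ({i | rank x i < q} : Finset (Fin n)), rank x i / p ∈ range (q / p + 1) := by
    intro i hi
    simp only [mem_filter, mem_univ, true_and] at hi
    exact mem_range.2 (Nat.lt_succ_of_le (Nat.div_le_div_right hi.le))
  rw [← sum_fiberwise_of_maps_to hmaps]
  simp only [filter_filter]
  refine (sum_le_sum fun b _ => h b).trans ?_
  rw [sum_const, card_range, nsmul_eq_mul]
  have h1 : ((q / p : ℕ) : ℝ) * p ≤ q := by exact_mod_cast Nat.div_mul_le_self q p
  push_cast
  nlinarith

lemma card_block_le {n : ℕ} (x : Fin n → ℝ) {p : ℕ} (hp : 0 < p) (q b : ℕ) :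
    #{i | rank x i < q ∧ rank x i / p = b} ≤ p := by
  rw [← card_map ⟨rank x, rank_injective x⟩]
  refine (card_le_card (t := Finset.Ico (b * p) (b * p + p)) fun a ha => ?_).trans (by simp)
  simp only [mem_map, mem_filter, mem_univ, true_and, Function.Embedding.coeFn_mk] at ha
  obtain ⟨i, ⟨_, hi⟩, rfl⟩ := ha
  rw [Finset.mem_Ico]
  have h1 := Nat.div_add_mod (rank x i) p
  have h2 := Nat.mod_lt (rank x i) hp
  rw [hi, mul_comm] at h1
  omega

/-- The squared error on the top `2k` coordinates, bounded by splitting them into blocks. -/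
lemma law_real_sum_top_le {n k R C p : ℕ} [NeZero C] (x : Fin n → ℝ) (hk : k ≤ n)
    (hk1 : 1 ≤ k) {σ : ℝ} (hσ : 0 < σ) (hσC : σ ^ 2 * C = 40 * l2norm (tail k x) ^ 2)
    (hp : 0 < p) (hC : 10 * ((k : ℝ) + p) ≤ C)
    (hR : 0 < R) (hpR : 40000 * (p : ℝ) ≤ R)
    (hpC : p * Real.exp (p * (40000 * p / R)) ≤ C) :
    (law n R C).real {ω | 2 * 40000 * (σ ^ 2 / R) * (2 * k + p) <
        ∑ i with rank x i < 2 * k, (estimate ω x i - x i) ^ 2} ≤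
      4 * k * Real.exp (-p) := by
  have hR' : (0 : ℝ) < R := by exact_mod_cast hR
  have hsub : {ω : Hashing n R C | 2 * 40000 * (σ ^ 2 / R) * (2 * k + p) <
        ∑ i with rank x i < 2 * k, (estimate ω x i - x i) ^ 2} ⊆
      ⋃ b ∈ range (2 * k + 1), {ω | 2 * 40000 * p * (σ ^ 2 / R) <
        ∑ i with rank x i < 2 * k ∧ rank x i / p = b, (estimate ω x i - x i) ^ 2} := by
    intro ω hω
    by_contra hcon
    simp only [Set.mem_iUnion, not_exists, mem_range, Set.mem_ofPred_eq, not_lt] at hcon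
    refine absurd (sum_top_le_of_blocks x (fun i => (estimate ω x i - x i) ^ 2) (p := p) (q := 2 * k)
      (M := 2 * 40000 * (σ ^ 2 / R)) (by positivity) fun b => ?_) ?_
    · by_cases hb : b < 2 * k + 1
      · refine (hcon b hb).trans (le_of_eq (by ring))
      · rw [filter_false_of_mem, sum_empty]
        · positivity
        · rintro i - ⟨h1, h2⟩
          have := Nat.div_le_self (rank x i) p
          omega
    · push_cast
      exact not_le.2 hω
  refine (MeasureTheory.measureReal_mono hsub (MeasureTheory.measure_ne_top _ _)).trans
    ((MeasureTheory.measureReal_biUnion_finset_le _ _).trans ?_)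
  refine (sum_le_sum fun b _ => law_real_block_le x hk hk1 hσ hσC _ (card_block_le x hp _ b) hC hR
    hpR hpC).trans ?_
  rw [sum_const, card_range, nsmul_eq_mul]
  refine mul_le_mul_of_nonneg_right ?_ (Real.exp_pos _).le
  have : (1 : ℝ) ≤ k := by exact_mod_cast hk1
  push_cast
  linarith

/-! ### The top-`k` estimation error -/

/-- The top-`k` error bound, with explicit failure probability: the first term accounts for a
coordinate with an error beyond the scale `σ` of a single row, the second one for a block of `p` top
coordinates with a large total error. -/
lemma one_sub_le_law_real_topError {n k R C p : ℕ} [NeZero C] (x : Fin n → ℝ) (hkn : 2 * k ≤ n)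
    (hk : 1 ≤ k) {σ : ℝ} (hσ0 : 0 ≤ σ) (hσC : σ ^ 2 * C = 40 * l2norm (tail k x) ^ 2)
    (hσgap : σ ≤ (mag x k - mag x (2 * k)) / 3)
    (hp : 0 < p) (hpC : 3200000 * (2 * (k : ℝ) + p) ≤ C)
    (hR : 0 < R) (hpR : 40000 * (p : ℝ) ≤ R)
    (hpexp : p * Real.exp (p * (40000 * p / R)) ≤ C) :
    1 - (n * (2 * Real.exp (-R / 10000)) + 4 * k * Real.exp (-p)) ≤
      (law n R C).real {ω | topError k x (estimate ω x) ^ 2 ≤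
        1 / (R : ℝ) * l2norm (tail k x) ^ 2} := by
  have hk' : (1 : ℝ) ≤ k := by exact_mod_cast hk
  have hp' : (1 : ℝ) ≤ p := by exact_mod_cast hp
  have hCpos : (0 : ℝ) < C := by linarith
  set N := l2norm (tail k x) with hN
  let bad₁ : Set (Hashing n R C) := {ω | ∃ i, σ < |estimate ω x i - x i|}
  let bad₂ : Set (Hashing n R C) := {ω | 0 < σ ∧ 2 * 40000 * (σ ^ 2 / R) * (2 * k + p) <
        ∑ i with rank x i < 2 * k, (estimate ω x i - x i) ^ 2}
  have hbad₁ : (law n R C).real bad₁ ≤ n * (2 * Real.exp (-R / 10000)) :=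
    law_real_exists_deviation_le x (by omega) hk hσ0 hσC (by linarith)
  have hbad₂ : (law n R C).real bad₂ ≤ 4 * k * Real.exp (-p) := by
    rcases hσ0.eq_or_lt with h | h
    · have : bad₂ = ∅ := by
        ext ω
        simp [bad₂, ← h]
      rw [this, MeasureTheory.measureReal_empty]
      positivity
    · exact (MeasureTheory.measureReal_mono (fun ω hω => hω.2)
        (MeasureTheory.measure_ne_top _ _)).trans
        (law_real_sum_top_le x (by omega) hk h hσC hp (by linarith) hR hpR hpexp)
  have hcover : (Set.univ : Set (Hashing n R C)) ⊆
      {ω | topError k x (estimate ω x) ^ 2 ≤ 1 / (R : ℝ) * N ^ 2} ∪ (bad₁ ∪ bad₂) := by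
    intro ω _
    by_contra hcon
    simp only [Set.mem_union, not_or] at hcon
    obtain ⟨hgood, h1, h2⟩ := hcon
    apply hgood
    have herr : ∀ i, |estimate ω x i - x i| ≤ σ := fun i => by
      by_contra h
      exact h1 ⟨i, not_le.1 h⟩
    refine (topError_sq_le hk hkn x (estimate ω x) fun i => (herr i).trans hσgap).trans ?_
    rcases hσ0.eq_or_lt with h | h
    · have : ∑ i with rank x i < 2 * k, (estimate ω x i - x i) ^ 2 = 0 :=
        sum_eq_zero fun i _ => by
          have := herr i
          rw [← h] at this
          rw [abs_nonpos_iff.1 this, zero_pow two_ne_zero]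
      rw [this]
      positivity
    · have h3 : ∑ i with rank x i < 2 * k, (estimate ω x i - x i) ^ 2 ≤
          2 * 40000 * (σ ^ 2 / R) * (2 * k + p) := by
        by_contra hh
        exact h2 ⟨h, not_le.1 hh⟩
      refine h3.trans ?_
      rw [eq_div_of_mul_eq hCpos.ne' hσC]
      have h4 : 2 * 40000 * (40 * N ^ 2 / C / R) * (2 * k + p) =
          1 / R * N ^ 2 * (3200000 * (2 * k + p) / C) := by field_simp; ring
      rw [h4]
      refine mul_le_of_le_one_right (by positivity) ?_
      rw [div_le_one hCpos]
      linarith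
  have h1 : (1 : ℝ) ≤ (law n R C).real
      ({ω | topError k x (estimate ω x) ^ 2 ≤ 1 / (R : ℝ) * N ^ 2} ∪ (bad₁ ∪ bad₂)) := by
    exact (MeasureTheory.probReal_univ (μ := law n R C)).symm.le.trans
      (MeasureTheory.measureReal_mono hcover (MeasureTheory.measure_ne_top _ _))
  have h2 := MeasureTheory.measureReal_union_le (μ := law n R C)
    {ω | topError k x (estimate ω x) ^ 2 ≤ 1 / (R : ℝ) * N ^ 2} (bad₁ ∪ bad₂)
  have h3 := MeasureTheory.measureReal_union_le (μ := law n R C) bad₁ bad₂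
  linarith

end CountSketch

open CountSketch

theorem mainTheorem3 (d : ℝ) (hd : 0 < d) :
    ∃ A : ℝ, 0 < A ∧
      ∀ α : ℝ, 0 < α →
        ∃ c₀ : ℝ, 0 < c₀ ∧
          ∀ c₁ : ℝ, c₀ ≤ c₁ →
            ∃ K : ℝ, 0 < K ∧
              ∀ (n k R C : ℕ) (x : Fin n → ℝ),
                1 ≤ k → 2 * k ≤ n →
                A * Real.log n ≤ R →
                c₀ * k ≤ C → C ≤ c₁ * k →
                α * (CountSketch.l2norm (CountSketch.tail k x) / √(k : ℝ)) ≤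
                  CountSketch.mag x k - CountSketch.mag x (2 * k) →
                1 - K / (k : ℝ) ^ d ≤
                  (CountSketch.law n R C).real
                    {ω | CountSketch.topError k x (CountSketch.estimate ω x) ^ 2 ≤
                      1 / (R : ℝ) * CountSketch.l2norm (CountSketch.tail k x) ^ 2} := by
  obtain ⟨E, hE⟩ : ∃ E : ℝ, E = d + 3 := ⟨_, rfl⟩
  -- `A` makes the joint tail of `p ≤ E * log (2k)` coordinates affordable; `c₀` makes collisions rare,
  -- and its second term brings the scale of a single row below a third of the gap.
  refine ⟨80000 * E ^ 2, by rw [hE]; positivity, fun α hα => ?_⟩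
  have hE3 : 3 ≤ E := by linarith
  refine ⟨12800000 * E + 360 / α ^ 2, by positivity, fun c₁ _ => ⟨4, by norm_num, ?_⟩⟩
  intro n k R C x hk hkn hR hC _ hgap
  have hk' : (1 : ℝ) ≤ k := by exact_mod_cast hk
  have hkn' : 2 * (k : ℝ) ≤ n := by exact_mod_cast hkn
  have hC1 : 12800000 * E * k ≤ C := by
    have : 0 ≤ 360 / α ^ 2 * k := by positivity
    linarith
  have hC2 : 360 / α ^ 2 * k ≤ C := by
    have : 0 ≤ 12800000 * E * k := by positivity
    linarith
  have hEk : 3 * (k : ℝ) ≤ E * k := mul_le_mul_of_nonneg_right hE3 (by linarith)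
  have hCpos : (0 : ℝ) < C := by linarith
  have : NeZero C := ⟨by rintro rfl; simp at hCpos⟩
  obtain ⟨l, hl⟩ : ∃ l : ℝ, l = Real.log (2 * k) := ⟨_, rfl⟩
  have hexpl : Real.exp l = 2 * k := by rw [hl, Real.exp_log (by positivity)]
  have hl2 : 1 / 2 ≤ l := by
    have h1 : Real.log 2 ≤ l := by
      rw [hl]; exact Real.log_le_log (by norm_num) (by linarith)
    linarith [Real.log_two_gt_d9]
  have hln : l ≤ Real.log n := by
    rw [hl]; exact Real.log_le_log (by positivity) hkn'
  have hRl : 80000 * E ^ 2 * l ≤ R :=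
    (mul_le_mul_of_nonneg_left hln (by positivity)).trans hR
  have hRpos : (0 : ℝ) < R := lt_of_lt_of_le (by positivity) hRl
  have hR0 : 0 < R := by exact_mod_cast hRpos
  -- Blocks of size `p` of order `log (2 * k)`.
  obtain ⟨p, hp⟩ : ∃ p : ℕ, p = ⌈(d + 1) * l⌉₊ := ⟨_, rfl⟩
  have hp1 : (d + 1) * l ≤ p := by rw [hp]; exact Nat.le_ceil _
  have hp2 : (p : ℝ) ≤ E * l := by
    have h1 := Nat.ceil_lt_add_one (show 0 ≤ (d + 1) * l by positivity)
    rw [← hp] at h1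
    rw [hE]; linarith
  have hp0 : 0 < p := by rw [hp]; exact Nat.ceil_pos.2 (by positivity)
  have hp1' : (1 : ℝ) ≤ p := by exact_mod_cast hp0
  have hlk : l ≤ 2 * k := by
    have := Real.add_one_le_exp l
    linarith
  have hpk : (p : ℝ) ≤ 2 * (E * k) := by
    linarith [mul_le_mul_of_nonneg_left hlk (show 0 ≤ E by linarith)]
  have hpR : 40000 * (p : ℝ) ≤ R := by
    have h1 : E * l ≤ E ^ 2 * l := mul_le_mul_of_nonneg_right (by nlinarith) (by linarith)
    have h2 : 0 ≤ E ^ 2 * l := by positivity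
    linarith
  have hpexp : p * Real.exp (p * (40000 * p / R)) ≤ C := by
    have h1 : p * (40000 * p / R) ≤ l / 2 := by
      rw [← mul_div_assoc, div_le_iff₀ hRpos]
      have h2 : (p : ℝ) * p ≤ (E * l) * (E * l) :=
        mul_le_mul hp2 hp2 (by positivity) (by positivity)
      have h3 := mul_le_mul_of_nonneg_left hRl (show 0 ≤ l / 2 by linarith)
      linarith
    have h2 : l / 2 ≤ Real.exp (l / 2) := by linarith [Real.add_one_le_exp (l / 2)]
    have h3 : Real.exp (l / 2) * Real.exp (l / 2) = 2 * k := by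
      rw [← Real.exp_add, add_halves, hexpl]
    calc p * Real.exp (p * (40000 * p / R)) ≤ (E * l) * Real.exp (l / 2) :=
          mul_le_mul hp2 (Real.exp_le_exp.2 h1) (Real.exp_pos _).le (by positivity)
      _ = 2 * E * (l / 2 * Real.exp (l / 2)) := by ring
      _ ≤ 2 * E * (Real.exp (l / 2) * Real.exp (l / 2)) := by gcongr
      _ = 4 * (E * k) := by rw [h3]; ring
      _ ≤ C := by linarith
  -- The scale of the error of a single row.
  set N := l2norm (tail k x) with hN
  have hN0 : 0 ≤ N := l2norm_nonneg _
  obtain ⟨σ, hσ⟩ : ∃ σ : ℝ, σ = √(40 / C) * N := ⟨_, rfl⟩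
  have hσ0 : 0 ≤ σ := by rw [hσ]; positivity
  have hσsq : σ ^ 2 = 40 / C * N ^ 2 := by
    rw [hσ, mul_pow, Real.sq_sqrt (by positivity)]
  have hσC : σ ^ 2 * C = 40 * N ^ 2 := by rw [hσsq]; field_simp
  have hσgap : σ ≤ (mag x k - mag x (2 * k)) / 3 := by
    have h1 : σ ≤ α * (N / √k) / 3 := by
      refine (sq_le_sq₀ hσ0 (by positivity)).1 ?_
      have h2 : (α * (N / √k) / 3) ^ 2 = α ^ 2 / (9 * k) * N ^ 2 := by
        rw [div_pow, mul_pow, div_pow, Real.sq_sqrt (by positivity)]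
        field_simp
        norm_num
      rw [hσsq, h2]
      refine mul_le_mul_of_nonneg_right ?_ (sq_nonneg N)
      rw [div_le_div_iff₀ hCpos (by positivity)]
      rw [div_mul_eq_mul_div, div_le_iff₀ (by positivity)] at hC2
      linarith
    linarith
  have hkd : (k : ℝ) ^ d ≤ Real.exp (d * l) := by
    rw [Real.rpow_def_of_pos (by linarith)]
    refine Real.exp_le_exp.2 ?_
    have : Real.log k ≤ l := by rw [hl]; exact Real.log_le_log (by linarith) (by linarith)
    have := mul_le_mul_of_nonneg_left this hd.le
    linarith
  have hkdpos : 0 < (k : ℝ) ^ d := Real.rpow_pos_of_pos (by linarith) d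
  have hexpd : Real.exp (-(d * l)) ≤ 1 / (k : ℝ) ^ d := by
    rw [Real.exp_neg, ← one_div]
    exact one_div_le_one_div_of_le hkdpos hkd
  have hfail₁ : n * (2 * Real.exp (-R / 10000)) ≤ 2 / (k : ℝ) ^ d := by
    have hn : (0 : ℝ) < n := by linarith
    have h1 : Real.exp (-R / 10000) ≤ Real.exp (-((d + 1) * Real.log n)) := by
      refine Real.exp_le_exp.2 ?_
      have h0 : 0 ≤ Real.log n := by linarith
      have hEE : E * 1 ≤ E * E := mul_le_mul_of_nonneg_left (by linarith) (by linarith)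
      have h2 : 10000 * (d + 1) ≤ 80000 * E ^ 2 := by rw [sq]; linarith
      have := (mul_le_mul_of_nonneg_right h2 h0).trans hR
      linarith
    have h2 : Real.exp (-((d + 1) * Real.log n)) = Real.exp (-(d * Real.log n)) / n := by
      rw [show -((d + 1) * Real.log n) = -(d * Real.log n) - Real.log n by ring, Real.exp_sub,
        Real.exp_log hn]
    have h3 : Real.exp (-(d * Real.log n)) ≤ Real.exp (-(d * l)) :=
      Real.exp_le_exp.2 (neg_le_neg (mul_le_mul_of_nonneg_left hln hd.le))
    calc n * (2 * Real.exp (-R / 10000)) ≤ n * (2 * (Real.exp (-(d * Real.log n)) / n)) := by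
          rw [← h2]; gcongr
      _ = 2 * Real.exp (-(d * Real.log n)) := by field_simp
      _ ≤ 2 * (1 / (k : ℝ) ^ d) := by linarith
      _ = 2 / (k : ℝ) ^ d := by ring
  have hfail₂ : 4 * k * Real.exp (-p) ≤ 2 / (k : ℝ) ^ d := by
    have h2 : Real.exp (-p) ≤ Real.exp (-(d * l)) / (2 * k) := by
      rw [← hexpl, ← Real.exp_sub]
      exact Real.exp_le_exp.2 (by linarith)
    calc 4 * k * Real.exp (-p) ≤ 4 * k * (Real.exp (-(d * l)) / (2 * k)) := by gcongr
      _ = 2 * Real.exp (-(d * l)) := by field_simp; ring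
      _ ≤ 2 * (1 / (k : ℝ) ^ d) := by linarith
      _ = 2 / (k : ℝ) ^ d := by ring
  have h := one_sub_le_law_real_topError x hkn hk hσ0 hσC hσgap hp0 (by linarith) hR0 hpR hpexp
  have h4 : 4 / (k : ℝ) ^ d = 2 / (k : ℝ) ^ d + 2 / (k : ℝ) ^ d := by ring
  linarith
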